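/- Let $\Sigma=(A,B,C,D)$ be a real linear time-invariant system $\dot x=Ax+Bu$, $y=Cx+Du$ with state space $\mathbb{R}^n$ and $m$ inputs and $m$ outputs, and let $\Sigma^a=(-A^\top,-C^\top,B^\top,D^\top)$ be its adjoint system. Let $K(s)=C(sI-A)^{-1}B+D$ be the transfer matrix of $\Sigma$, and suppose that $\Sigma$ is minimal, i.e. no system with transfer matrix $K$ has a state space of smaller dimension. For a signature matrix $\sigma$ (a diagonal $m\times m$ matrix with diagonal entries $\pm1$), $\Sigma$ is called input-output Hamiltonian with respect to $\sigma$ if $\sigma K(s)=K^\top(-s)\,\sigma$ as rational matrix functions. Let $\mathcal{S}$ be the space of signals $u\in L_2((-\infty,\infty),\mathbb{R}^m)$ of compact support, with inner product $\langle u,v\rangle=\int_{-\infty}^\infty u(t)^\top v(t)\,dt$. The input-output behavior of compact support $\mathfrak{B}_c(\Sigma)\subset\mathcal{S}\times\mathcal{S}$ is the set of all $(u,y)\in\mathcal{S}\times\mathcal{S}$ for which there is a (locally absolutely continuous) state trajectory $x:(-\infty,\infty)\to\mathbb{R}^n$ with $\dot x=Ax+Bu$ and $y=Cx+Du$ almost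 everywhere. The restricted Volterra operator $\mathcal{V}$ is the operator $(\mathcal{V}u)(t)=\int_{-\infty}^t Ce^{A(t-\tau)}Bu(\tau)\,d\tau+Du(t)$ with domain the set of all $u\in\mathcal{S}$ such that $\mathcal{V}u\in\mathcal{S}$. Then $\Sigma$ is input-output Hamiltonian with respect to $\sigma=I$ if and only if $\mathfrak{B}_c(\Sigma)=\mathfrak{B}_c(\Sigma^a)$. More generally, for every signature matrix $\sigma$ the following statements are equivalent: 1. $\Sigma$ is input-output Hamiltonian with respect to $\sigma$; 2. $\{(\sigma u,\sigma y) : (u,y)\in\mathfrak{B}_c(\Sigma)\}=\mathfrak{B}_c(\Sigma^a)$; 3. $\sigma\mathcal{V}$ is symmetric: $\langle\sigma\mathcal{V}u,v\rangle=\langle u,\sigma\mathcal{V}v\rangle$ for all $u,v$ in the domain of $\mathcal{V}$; 4. $\sigma\mathcal{V}$ is self-adjoint in $\mathcal{S}$: for all $v,w\in\mathcal{S}$, one has that $v$ is in the domain of $\mathcal{V}$ and $\sigma\mathcal{V}v=w$ if and only if $\langle\sigma\mathcal{V}u,v\rangle=\langle u,w\rangle$ for all $u$ in the domain of $\mathcal{V}$;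 5. $\mathcal{L}=\{(u,\sigma y) : (u,y)\in\mathfrak{B}_c(\Sigma)\}$ is a Lagrangian subspace of $\mathcal{S}\times\mathcal{S}$, i.e. $\mathcal{L}$ equals its orthogonal companion with respect to the symplectic form $\langle e_a,f_b\rangle-\langle e_b,f_a\rangle$ of $(f_a,e_a),(f_b,e_b)\in\mathcal{S}\times\mathcal{S}$. -/

import Mathlib

open MeasureTheory Matrix

noncomputable section

/-! ### Linear systems -/

/-- A finite-dimensional linear time-invariant system `ẋ = A x + B u`, `y = C x + D u` with state
space `ℝⁿ` and with `m` inputs and `m` outputs. -/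
structure LTISystem (n m : ℕ) where
  A : Matrix (Fin n) (Fin n) ℝ
  B : Matrix (Fin n) (Fin m) ℝ
  C : Matrix (Fin m) (Fin n) ℝ
  D : Matrix (Fin m) (Fin m) ℝ

/-- A signature matrix: a diagonal matrix with entries `1` and `-1` on the diagonal. -/
def IsSignatureMatrix {m : ℕ} (σ : Matrix (Fin m) (Fin m) ℝ) : Prop :=
  ∃ d : Fin m → ℝ, (∀ i, d i = 1 ∨ d i = -1) ∧ σ = Matrix.diagonal d

/-- A real matrix, regarded as a complex one. -/
def toComplexMatrix {k l : ℕ} (M : Matrix (Fin k) (Fin l) ℝ) : Matrix (Fin k) (Fin l) ℂ :=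
  M.map (fun r : ℝ => (r : ℂ))

namespace LTISystem

variable {n m : ℕ}

/-- The adjoint system `(-Aᵀ, -Cᵀ, Bᵀ, Dᵀ)`. -/
def adjoint (S : LTISystem n m) : LTISystem n m where
  A := -S.Aᵀ
  B := -S.Cᵀ
  C := S.Bᵀ
  D := S.Dᵀ

/-- The complex number `s` is not a pole of the resolvent of `A`, i.e. `sI - A` is invertible. -/
def Regular (S : LTISystem n m) (s : ℂ) : Prop :=
  IsUnit (s • (1 : Matrix (Fin n) (Fin n) ℂ) - toComplexMatrix S.A)

/-- The transfer matrix `K(s) = C (sI - A)⁻¹ B + D`; meaningful where `S.Regular s`. -/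
def transfer (S : LTISystem n m) (s : ℂ) : Matrix (Fin m) (Fin m) ℂ :=
  toComplexMatrix S.C * (s • (1 : Matrix (Fin n) (Fin n) ℂ) - toComplexMatrix S.A)⁻¹
    * toComplexMatrix S.B + toComplexMatrix S.D

/-- Two systems, possibly with different state space dimensions, have the same transfer matrix:
the two rational matrix functions agree wherever both formulas are defined (all but finitely many
complex numbers). -/
def SameTransfer {n' : ℕ} (S : LTISystem n m) (S' : LTISystem n' m) : Prop :=
  ∀ s : ℂ, S.Regular s → S'.Regular s → S.transfer s = S'.transfer s

/-- A minimal system: no system with the same transfer matrix has a state space of smaller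
dimension. -/
def IsMinimal (S : LTISystem n m) : Prop :=
  ∀ (n' : ℕ) (S' : LTISystem n' m), S.SameTransfer S' → n ≤ n'

/-- The system is input-output Hamiltonian with respect to `σ`: `σ K(s) = K(-s)ᵀ σ` as rational
matrix functions. -/
def IsIOHamiltonian (S : LTISystem n m) (σ : Matrix (Fin m) (Fin m) ℝ) : Prop :=
  ∀ s : ℂ, S.Regular s → S.Regular (-s) →
    toComplexMatrix σ * S.transfer s = (S.transfer (-s))ᵀ * toComplexMatrix σ

end LTISystem

/-! ### Signals of compact support -/

/-- The space `L₂(-∞,∞)` of square integrable signals on the time axis `ℝ` with values in `ℝᵐ`. -/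
abbrev L2Signal (m : ℕ) : Type := Lp (EuclideanSpace ℝ (Fin m)) 2 (volume : Measure ℝ)

/-- The subspace of signals of compact support: those that vanish almost everywhere outside some
bounded interval. -/
def compactSignals (m : ℕ) : Submodule ℝ (L2Signal m) where
  carrier := {u | ∃ R : ℝ, ∀ᵐ t : ℝ, R < |t| → u t = 0}
  zero_mem' := ⟨0, by
    filter_upwards [Lp.coeFn_zero (EuclideanSpace ℝ (Fin m)) 2 (volume : Measure ℝ)] with t h _
    simp⟩
  add_mem' := by
    rintro u v ⟨R, hR⟩ ⟨R', hR'⟩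
    refine ⟨max R R', ?_⟩
    filter_upwards [hR, hR', Lp.coeFn_add u v] with t h h' e ht
    rw [e, Pi.add_apply, h (lt_of_le_of_lt (le_max_left _ _) ht),
      h' (lt_of_le_of_lt (le_max_right _ _) ht), add_zero]
  smul_mem' := by
    rintro c u ⟨R, hR⟩
    refine ⟨R, ?_⟩
    filter_upwards [hR, Lp.coeFn_smul c u] with t h e ht
    rw [e, Pi.smul_apply, h ht, smul_zero]

/-- The type of square integrable signals of compact support, with the `L₂` inner product
`⟪u, v⟫ = ∫ u(t)ᵀ v(t) dt`. -/
abbrev CSignal (m : ℕ) : Type := compactSignals m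

/-- Pointwise multiplication of a signal of compact support by a constant matrix,
`(M u)(t) = M u(t)`. -/
def matrixAct {m : ℕ} (M : Matrix (Fin m) (Fin m) ℝ) : CSignal m →ₗ[ℝ] CSignal m :=
  LinearMap.restrict
    ((Matrix.toEuclideanCLM (𝕜 := ℝ) M).compLpₗ 2 (volume : Measure ℝ))
    (p := compactSignals m) (q := compactSignals m) (by
      rintro u ⟨R, hR⟩
      refine ⟨R, ?_⟩
      filter_upwards [hR, ContinuousLinearMap.coeFn_compLp
        (Matrix.toEuclideanCLM (𝕜 := ℝ) M) u] with t h e ht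
      have e' := e
      rw [h ht, map_zero] at e'
      exact e')

lemma matrixAct_ae {m : ℕ} (M : Matrix (Fin m) (Fin m) ℝ) (u : CSignal m) :
    ∀ᵐ t : ℝ, ((matrixAct M u).1 t).ofLp = M *ᵥ (u.1 t).ofLp := by
  filter_upwards [ContinuousLinearMap.coeFn_compLp
    (Matrix.toEuclideanCLM (𝕜 := ℝ) M) u.1] with t e
  exact congrArg WithLp.ofLp e

lemma CSignal.add_ae {m : ℕ} (u v : CSignal m) :
    ∀ᵐ t : ℝ, (u + v).1 t = u.1 t + v.1 t := Lp.coeFn_add u.1 v.1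

lemma CSignal.smul_ae {m : ℕ} (c : ℝ) (u : CSignal m) :
    ∀ᵐ t : ℝ, (c • u).1 t = c • u.1 t := Lp.coeFn_smul c u.1

/-- A signal of compact support multiplied by a continuous matrix function is integrable. -/
lemma CSignal.integrable_mulVec {m k : ℕ} (u : CSignal m) (F : ℝ → Matrix (Fin k) (Fin m) ℝ)
    (hF : Continuous F) : Integrable (fun t => F t *ᵥ (u.1 t).ofLp) := by
  obtain ⟨R, hR⟩ := u.2
  have hu : LocallyIntegrable (fun t => u.1 t) volume :=
    (Lp.memLp u.1).locallyIntegrable (by norm_num)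
  have hI : IntegrableOn (fun t => u.1 t) (Set.Icc (-R) R) := hu.integrableOn_isCompact isCompact_Icc
  refine IntegrableOn.integrable_of_ae_notMem_eq_zero (s := Set.Icc (-R) R) ?_ ?_
  · refine Integrable.of_eval fun i => ?_
    simp only [Matrix.mulVec, dotProduct]
    refine integrable_finsetSum _ fun j _ => ?_
    have hj : IntegrableOn (fun t => (u.1 t).ofLp j) (Set.Icc (-R) R) :=
      (EuclideanSpace.proj (𝕜 := ℝ) j).integrable_comp hI
    exact hj.continuousOn_mul (hF.matrix_elem i j).continuousOn isCompact_Icc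
  · filter_upwards [hR] with t h ht
    have : R < |t| := by
      by_contra hc
      exact ht (abs_le.mp (not_lt.mp hc))
    simp [h this]

namespace LTISystem

variable {n m : ℕ}

/-! ### Input-output trajectories -/

/-- `(x, u, y)` satisfies the system equations on the whole time axis `(-∞,∞)`. Here
`ẋ = A x + B u` is understood in integrated form (`x` is locally absolutely continuous and satisfies
the differential equation almost everywhere), and `y = C x + D u` almost everywhere. -/
def IsTrajectory (S : LTISystem n m) (x : ℝ → Fin n → ℝ) (u y : CSignal m) : Prop :=
  Continuous x ∧
  (∀ a b : ℝ, x b - x a = ∫ t in a..b, (S.A *ᵥ x t + S.B *ᵥ (u.1 t).ofLp)) ∧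
  ∀ᵐ t : ℝ, (y.1 t).ofLp = S.C *ᵥ x t + S.D *ᵥ (u.1 t).ofLp

/-- The right-hand side of the state equation is integrable on bounded intervals. -/
lemma intervalIntegrable_rhs (S : LTISystem n m) {x : ℝ → Fin n → ℝ} (hx : Continuous x)
    (u : CSignal m) (a b : ℝ) :
    IntervalIntegrable (fun t => S.A *ᵥ x t + S.B *ᵥ (u.1 t).ofLp) volume a b :=
  ((continuous_const.matrix_mulVec hx).intervalIntegrable a b).add
    (u.integrable_mulVec (fun _ => S.B) continuous_const).intervalIntegrable

/-- The input-output behavior of compact support: all pairs `(u, y)` of signals of compact support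
for which there is a state trajectory `x` such that `(x, u, y)` satisfies the system equations. -/
def compactBehavior (S : LTISystem n m) : Submodule ℝ (CSignal m × CSignal m) where
  carrier := {w | ∃ x : ℝ → Fin n → ℝ, S.IsTrajectory x w.1 w.2}
  zero_mem' := by
    have h0 : ∀ᵐ t : ℝ, (0 : CSignal m).1 t = 0 :=
      Lp.coeFn_zero (EuclideanSpace ℝ (Fin m)) 2 (volume : Measure ℝ)
    refine ⟨fun _ => 0, continuous_const, fun a b => ?_, ?_⟩
    · rw [intervalIntegral.integral_congr_ae (g := fun _ => (0 : Fin n → ℝ))]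
      · simp
      · filter_upwards [h0] with t h _
        simp [h]
    · filter_upwards [h0] with t h
      simp [h]
  add_mem' := by
    rintro ⟨u, y⟩ ⟨u', y'⟩ ⟨x, hx, hd, ho⟩ ⟨x', hx', hd', ho'⟩
    refine ⟨fun t => x t + x' t, hx.add hx', fun a b => ?_, ?_⟩
    · have e : x b + x' b - (x a + x' a) = (x b - x a) + (x' b - x' a) := by abel
      simp only [e, hd, hd']
      rw [← intervalIntegral.integral_add (S.intervalIntegrable_rhs hx u a b)
        (S.intervalIntegrable_rhs hx' u' a b)]
      refine intervalIntegral.integral_congr_ae ?_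
      filter_upwards [CSignal.add_ae u u'] with t h _
      simp only [Prod.fst_add, h, WithLp.ofLp_add, Matrix.mulVec_add]
      abel
    · filter_upwards [ho, ho', CSignal.add_ae u u', CSignal.add_ae y y'] with t h h' e e'
      simp only [Prod.fst_add, Prod.snd_add, e, e', WithLp.ofLp_add, Matrix.mulVec_add] at h h' ⊢
      rw [h, h']
      abel
  smul_mem' := by
    rintro c ⟨u, y⟩ ⟨x, hx, hd, ho⟩
    refine ⟨fun t => c • x t, hx.const_smul c, fun a b => ?_, ?_⟩
    · simp only [← smul_sub, hd]
      rw [← intervalIntegral.integral_smul]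
      refine intervalIntegral.integral_congr_ae ?_
      filter_upwards [CSignal.smul_ae c u] with t h _
      simp only [Prod.smul_fst, h, WithLp.ofLp_smul, Matrix.mulVec_smul, smul_add]
    · filter_upwards [ho, CSignal.smul_ae c u, CSignal.smul_ae c y] with t h e e'
      simp only [Prod.smul_fst, Prod.smul_snd, e, e', WithLp.ofLp_smul, Matrix.mulVec_smul] at h ⊢
      rw [h, smul_add]

/-! ### The Volterra operator -/

/-- The regular part `C e^{At} B` of the impulse response matrix. -/
def impulse (S : LTISystem n m) (t : ℝ) : Matrix (Fin m) (Fin m) ℝ :=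
  S.C * NormedSpace.exp (t • S.A) * S.B

lemma continuous_impulse (S : LTISystem n m) : Continuous S.impulse := by
  let _ : NormedRing (Matrix (Fin n) (Fin n) ℝ) := Matrix.linftyOpNormedRing
  let _ : NormedAlgebra ℝ (Matrix (Fin n) (Fin n) ℝ) := Matrix.linftyOpNormedAlgebra
  let _ : NormedAlgebra ℚ (Matrix (Fin n) (Fin n) ℝ) := NormedAlgebra.restrictScalars ℚ ℝ _
  have h : Continuous (fun t : ℝ => NormedSpace.exp (t • S.A)) :=
    NormedSpace.exp_continuous.comp (continuous_id.smul continuous_const)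
  exact (continuous_const.matrix_mul h).matrix_mul continuous_const

/-- The output of the Volterra operator (system at rest at `t = -∞`):
`y(t) = ∫_{-∞}^t C e^{A(t-τ)} B u(τ) dτ + D u(t)`. -/
def volterraOutput (S : LTISystem n m) (u : CSignal m) (t : ℝ) : Fin m → ℝ :=
  (∫ τ in Set.Iic t, S.impulse (t - τ) *ᵥ (u.1 τ).ofLp) + S.D *ᵥ (u.1 t).ofLp

lemma volterraOutput_add (S : LTISystem n m) (u v : CSignal m) :
    ∀ᵐ t : ℝ, S.volterraOutput (u + v) t = S.volterraOutput u t + S.volterraOutput v t := by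
  filter_upwards [CSignal.add_ae u v] with t ht
  have hc : Continuous fun τ => S.impulse (t - τ) :=
    S.continuous_impulse.comp (continuous_const.sub continuous_id)
  have e : (∫ τ in Set.Iic t, S.impulse (t - τ) *ᵥ ((u + v).1 τ).ofLp)
      = (∫ τ in Set.Iic t, S.impulse (t - τ) *ᵥ (u.1 τ).ofLp)
        + ∫ τ in Set.Iic t, S.impulse (t - τ) *ᵥ (v.1 τ).ofLp := by
    rw [← integral_add (u.integrable_mulVec _ hc).integrableOn
      (v.integrable_mulVec _ hc).integrableOn]
    refine integral_congr_ae (ae_restrict_of_ae ?_)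
    filter_upwards [CSignal.add_ae u v] with τ h
    simp only [h, WithLp.ofLp_add, Matrix.mulVec_add]
  simp only [volterraOutput, e, ht, WithLp.ofLp_add, Matrix.mulVec_add]
  abel

lemma volterraOutput_smul (S : LTISystem n m) (c : ℝ) (u : CSignal m) :
    ∀ᵐ t : ℝ, S.volterraOutput (c • u) t = c • S.volterraOutput u t := by
  filter_upwards [CSignal.smul_ae c u] with t ht
  have e : (∫ τ in Set.Iic t, S.impulse (t - τ) *ᵥ ((c • u).1 τ).ofLp)
      = c • ∫ τ in Set.Iic t, S.impulse (t - τ) *ᵥ (u.1 τ).ofLp := by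
    rw [← integral_smul]
    refine integral_congr_ae (ae_restrict_of_ae ?_)
    filter_upwards [CSignal.smul_ae c u] with τ h
    simp only [h, WithLp.ofLp_smul, Matrix.mulVec_smul]
  simp only [volterraOutput, e, ht, WithLp.ofLp_smul, Matrix.mulVec_smul, smul_add]

/-- `y` is the output of the Volterra operator for the input `u`. -/
def IsVolterraOutput (S : LTISystem n m) (u y : CSignal m) : Prop :=
  ∀ᵐ t : ℝ, (y.1 t).ofLp = S.volterraOutput u t

lemma IsVolterraOutput.unique {S : LTISystem n m} {u y y' : CSignal m}
    (h : S.IsVolterraOutput u y) (h' : S.IsVolterraOutput u y') : y = y' := by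
  refine Subtype.ext (Lp.ext ?_)
  filter_upwards [h, h'] with t e e'
  exact WithLp.ofLp_injective 2 (e.trans e'.symm)

lemma IsVolterraOutput.add {S : LTISystem n m} {u v y z : CSignal m}
    (h : S.IsVolterraOutput u y) (h' : S.IsVolterraOutput v z) :
    S.IsVolterraOutput (u + v) (y + z) := by
  filter_upwards [h, h', CSignal.add_ae y z, S.volterraOutput_add u v] with t e e' ea eb
  rw [eb, ea, WithLp.ofLp_add, e, e']

lemma IsVolterraOutput.smul {S : LTISystem n m} {u y : CSignal m} (c : ℝ)
    (h : S.IsVolterraOutput u y) : S.IsVolterraOutput (c • u) (c • y) := by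
  filter_upwards [h, CSignal.smul_ae c y, S.volterraOutput_smul c u] with t e ea eb
  rw [eb, ea, WithLp.ofLp_smul, e]

/-- The Volterra operator, restricted to the inputs of compact support for which the output has
compact support as well. -/
def restrictedVolterra (S : LTISystem n m) : CSignal m →ₗ.[ℝ] CSignal m where
  domain :=
    { carrier := {u | ∃ y : CSignal m, S.IsVolterraOutput u y}
      zero_mem' := ⟨0, by
        have h := S.volterraOutput_smul 0 0
        have h0 : ∀ᵐ t : ℝ, (0 : CSignal m).1 t = 0 :=
          Lp.coeFn_zero (EuclideanSpace ℝ (Fin m)) 2 (volume : Measure ℝ)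
        filter_upwards [h, h0] with t e e0
        rw [zero_smul, zero_smul] at e
        rw [e, e0, WithLp.ofLp_zero]⟩
      add_mem' := by
        rintro u v ⟨y, hy⟩ ⟨z, hz⟩
        exact ⟨y + z, hy.add hz⟩
      smul_mem' := by
        rintro c u ⟨y, hy⟩
        exact ⟨c • y, hy.smul c⟩ }
  toFun :=
    { toFun := fun u => u.2.choose
      map_add' := fun u v => IsVolterraOutput.unique (u + v).2.choose_spec
        (u.2.choose_spec.add v.2.choose_spec)
      map_smul' := fun c u => IsVolterraOutput.unique (c • u).2.choose_spec
        (u.2.choose_spec.smul c) }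

end LTISystem

/-! ### Self-adjointness and Lagrangian subspaces in the space of signals of compact support -/

/-- A (partially defined) operator `T` on signals of compact support is symmetric:
`⟪T u, v⟫ = ⟪u, T v⟫` for all `u, v` in its domain. -/
def IsSymmetricOperator {m : ℕ} (T : CSignal m →ₗ.[ℝ] CSignal m) : Prop :=
  ∀ u v : T.domain, inner ℝ (T u) (v : CSignal m) = inner ℝ (u : CSignal m) (T v)

/-- A (partially defined) operator `T` on signals of compact support is self-adjoint: `T` equals its
adjoint, domains included. The adjoint is the operator that sends `v` to `w` exactly when
`⟪T u, v⟫ = ⟪u, w⟫` for all `u` in the domain of `T`. -/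
def IsSelfAdjointOperator {m : ℕ} (T : CSignal m →ₗ.[ℝ] CSignal m) : Prop :=
  ∀ v w : CSignal m, (v, w) ∈ T.graph ↔
    ∀ u : T.domain, inner ℝ (T u) v = inner ℝ (u : CSignal m) w

/-- The symplectic form `⟨(f_a, e_a), (f_b, e_b)⟩ = ∫ e_a(t)ᵀ f_b(t) - e_b(t)ᵀ f_a(t) dt` on pairs of
signals of compact support. -/
def symplecticForm {m : ℕ} (a b : CSignal m × CSignal m) : ℝ :=
  inner ℝ a.2 b.1 - inner ℝ b.2 a.1

/-- A subspace of the space of pairs of signals of compact support is Lagrangian if it equals its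
own orthogonal companion with respect to the symplectic form. -/
def IsLagrangian {m : ℕ} (L : Submodule ℝ (CSignal m × CSignal m)) : Prop :=
  ∀ a : CSignal m × CSignal m, a ∈ L ↔ ∀ b ∈ L, symplecticForm a b = 0

end

/-! Minimality enters only through two consequences: the system is observable, and so is its
adjoint, which is controllability of the system itself. If `S` is observable and `(u, y)` has
compact support, then far in the past the output is `C e^{tA} c` for a fixed `c`. This must vanish,
so `c = 0` and the state starts from rest. Hence the compact support behavior is the graph of the
restricted Volterra operator (`mem_compactBehavior_iff`), whose domain consists of the inputs with
`terminal u = ∫ e^{-tA} B u = 0`, a space of finite codimension.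

For such `u` the state has compact support, so integrating the derivative of `pᵀx` along an adjoint
trajectory `p` leaves no boundary term (`IsVolterraOutput.inner_eq`). The adjoint behavior is
therefore orthogonal to the graph. Conversely, a functional that vanishes on the domain is a
combination of the components of the terminal state, and such a combination can be absorbed into the
initial state of `p`. So the adjoint behavior is exactly the orthogonal companion of the graph
(`mem_adjoint_compactBehavior_iff`).

Put `T = S.adjoint.conj σ`, with transfer matrix `σ K(-s)ᵀ σ`. Statement 1 says that `S` and `T`
have the same transfer matrix, equivalently the same feedthrough and Markov parameters. Statements
2, 4 and 5 say that the behaviors of `S` and `T` coincide, while symmetry gives only one inclusion.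
The cycle closes because that inclusion already forces equal Markov parameters
(`sameMarkov_of_compactBehavior_le`): by controllability any input can be corrected at arbitrarily
late times so that it enters the domain, and by causality the earlier output does not notice. -/

namespace LTISystem

variable {n n' m : ℕ}

/-- The Markov parameters `C Aʲ B` of a system. -/
def markov (S : LTISystem n m) (j : ℕ) : Matrix (Fin m) (Fin m) ℝ := S.C * S.A ^ j * S.B

/-- Two systems have the same feedthrough matrix and the same Markov parameters. -/
def SameMarkov (S : LTISystem n m) (S' : LTISystem n' m) : Prop :=
  S.D = S'.D ∧ ∀ j, S.markov j = S'.markov j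

/-- Observability: an initial state is zero if all `C Aʲ x` vanish. -/
def IsObservable (S : LTISystem n m) : Prop :=
  ∀ x : Fin n → ℝ, (∀ j, S.C *ᵥ (S.A ^ j *ᵥ x) = 0) → x = 0

end LTISystem

/-! ### Complexification and the resolvent at infinity. -/

lemma toComplexMatrix_injective {k l : ℕ} :
    Function.Injective (toComplexMatrix : Matrix (Fin k) (Fin l) ℝ → Matrix (Fin k) (Fin l) ℂ) :=
  Matrix.map_injective Complex.ofReal_injective

lemma toComplexMatrix_mul {k l r : ℕ} (M : Matrix (Fin k) (Fin l) ℝ)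
    (N : Matrix (Fin l) (Fin r) ℝ) :
    toComplexMatrix (M * N) = toComplexMatrix M * toComplexMatrix N :=
  Matrix.map_mul (f := Complex.ofRealHom)

lemma toComplexMatrix_one {k : ℕ} :
    toComplexMatrix (1 : Matrix (Fin k) (Fin k) ℝ) = 1 :=
  Matrix.map_one _ Complex.ofReal_zero Complex.ofReal_one

lemma toComplexMatrix_neg {k l : ℕ} (M : Matrix (Fin k) (Fin l) ℝ) :
    toComplexMatrix (-M) = -toComplexMatrix M := by
  ext i j; simp [toComplexMatrix]

lemma toComplexMatrix_transpose {k l : ℕ} (M : Matrix (Fin k) (Fin l) ℝ) :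
    toComplexMatrix Mᵀ = (toComplexMatrix M)ᵀ := rfl

lemma toComplexMatrix_pow {k : ℕ} (M : Matrix (Fin k) (Fin k) ℝ) (j : ℕ) :
    toComplexMatrix (M ^ j) = toComplexMatrix M ^ j := by
  induction j with
  | zero => simp [toComplexMatrix_one]
  | succ j ih => rw [pow_succ, toComplexMatrix_mul, ih, pow_succ]

/-- The resolvent of a complex matrix tends to zero at infinity. -/
lemma tendsto_matrix_resolvent_zero {k : ℕ} (A : Matrix (Fin k) (Fin k) ℂ) :
    Filter.Tendsto (fun s : ℂ => (s • (1 : Matrix (Fin k) (Fin k) ℂ) - A)⁻¹)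
      (Bornology.cobounded ℂ) (nhds 0) := by
  let _ : NormedRing (Matrix (Fin k) (Fin k) ℂ) := Matrix.linftyOpNormedRing
  let _ : NormedAlgebra ℂ (Matrix (Fin k) (Fin k) ℂ) := Matrix.linftyOpNormedAlgebra
  have h := spectrum.resolvent_tendsto_cobounded (𝕜 := ℂ) A
  refine h.congr fun s => ?_
  rw [Matrix.nonsing_inv_eq_ringInverse, resolvent, Algebra.algebraMap_eq_smul_one]

/-! ### Transfer matrices and Markov parameters determine each other. -/

namespace LTISystem

variable {n n' m : ℕ}

lemma eventually_regular (S : LTISystem n m) : ∀ᶠ s in Bornology.cobounded ℂ, S.Regular s := by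
  let _ : NormedRing (Matrix (Fin n) (Fin n) ℂ) := Matrix.linftyOpNormedRing
  let _ : NormedAlgebra ℂ (Matrix (Fin n) (Fin n) ℂ) := Matrix.linftyOpNormedAlgebra
  have h : Bornology.IsBounded (spectrum ℂ (toComplexMatrix S.A)) :=
    spectrum.isBounded (𝕜 := ℂ) (toComplexMatrix S.A)
  filter_upwards [Bornology.isBounded_def.mp h] with s hs
  rw [Set.mem_compl_iff, spectrum.mem_iff, not_not, Algebra.algebraMap_eq_smul_one] at hs
  exact hs

/-- The strictly proper rational matrix `C Aʲ (sI - A)⁻¹ B`. -/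
noncomputable def shiftedTransfer (S : LTISystem n m) (j : ℕ) (s : ℂ) : Matrix (Fin m) (Fin m) ℂ :=
  toComplexMatrix S.C * toComplexMatrix S.A ^ j
    * (s • (1 : Matrix (Fin n) (Fin n) ℂ) - toComplexMatrix S.A)⁻¹ * toComplexMatrix S.B

lemma transfer_eq (S : LTISystem n m) (s : ℂ) :
    S.transfer s = S.shiftedTransfer 0 s + toComplexMatrix S.D := by
  simp [transfer, shiftedTransfer]

lemma tendsto_shiftedTransfer (S : LTISystem n m) (j : ℕ) :
    Filter.Tendsto (S.shiftedTransfer j) (Bornology.cobounded ℂ) (nhds 0) := by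
  have h := tendsto_matrix_resolvent_zero (toComplexMatrix S.A)
  have hc : Continuous fun M : Matrix (Fin n) (Fin n) ℂ =>
      toComplexMatrix S.C * toComplexMatrix S.A ^ j * M * toComplexMatrix S.B := by fun_prop
  have h0 := (hc.tendsto 0).comp h
  rw [Matrix.mul_zero, Matrix.zero_mul] at h0
  exact h0

/-- From `s R = 1 + A R` for the resolvent `R`. Each use peels one coefficient off the expansion of
the transfer matrix at infinity. -/
lemma smul_shiftedTransfer (S : LTISystem n m) (j : ℕ) {s : ℂ} (hs : S.Regular s) :
    s • S.shiftedTransfer j s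
      = toComplexMatrix (S.markov j) + S.shiftedTransfer (j + 1) s := by
  set A := toComplexMatrix S.A with hA
  set R := (s • (1 : Matrix (Fin n) (Fin n) ℂ) - A)⁻¹ with hR
  have h1 : (s • (1 : Matrix (Fin n) (Fin n) ℂ) - A) * R = 1 :=
    Matrix.mul_nonsing_inv _ ((Matrix.isUnit_iff_isUnit_det _).mp hs)
  have h2 : s • R = 1 + A * R := by
    rw [sub_mul, smul_mul_assoc, one_mul] at h1
    rw [← h1]; abel
  calc s • S.shiftedTransfer j s = toComplexMatrix S.C * A ^ j * (s • R) * toComplexMatrix S.B := by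
        simp [shiftedTransfer, hR, hA]
    _ = _ := by
        rw [h2]
        simp only [markov, shiftedTransfer, toComplexMatrix_mul, toComplexMatrix_pow,
          Matrix.mul_add, Matrix.add_mul, Matrix.mul_one, pow_succ, Matrix.mul_assoc, ← hA, ← hR]

/-- Comparison of the expansions at infinity, coefficient by coefficient: the remainders
`shiftedTransfer` tend to zero, so each coefficient is a limit determined by the transfer matrix. -/
lemma SameTransfer.sameMarkov {S : LTISystem n m} {S' : LTISystem n' m} (h : S.SameTransfer S') :
    S.SameMarkov S' := by
  have hreg : ∀ᶠ s in Bornology.cobounded ℂ, S.Regular s ∧ S'.Regular s :=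
    S.eventually_regular.and S'.eventually_regular
  have hD : S.D = S'.D := by
    apply toComplexMatrix_injective
    have t1 := (S.tendsto_shiftedTransfer 0).add_const (toComplexMatrix S.D)
    have t2 := (S'.tendsto_shiftedTransfer 0).add_const (toComplexMatrix S'.D)
    simp only [zero_add, ← transfer_eq] at t1 t2
    refine tendsto_nhds_unique (t1.congr' ?_) t2
    filter_upwards [hreg] with s hs using h s hs.1 hs.2
  have step : ∀ j, (∀ s, S.Regular s → S'.Regular s →
      S.shiftedTransfer j s = S'.shiftedTransfer j s) → S.markov j = S'.markov j := by
    intro j hj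
    apply toComplexMatrix_injective
    have t1 := (S.tendsto_shiftedTransfer (j + 1)).const_add (toComplexMatrix (S.markov j))
    have t2 := (S'.tendsto_shiftedTransfer (j + 1)).const_add (toComplexMatrix (S'.markov j))
    simp only [add_zero] at t1 t2
    refine tendsto_nhds_unique (t1.congr' ?_) t2
    filter_upwards [hreg] with s hs
    rw [← S.smul_shiftedTransfer j hs.1, ← S'.smul_shiftedTransfer j hs.2, hj s hs.1 hs.2]
  have all : ∀ j, ∀ s, S.Regular s → S'.Regular s →
      S.shiftedTransfer j s = S'.shiftedTransfer j s := by
    intro j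
    induction j with
    | zero =>
      intro s hs hs'
      have := h s hs hs'
      rwa [transfer_eq, transfer_eq, hD, add_left_inj] at this
    | succ j ih =>
      intro s hs hs'
      have e := S.smul_shiftedTransfer j hs
      rw [ih s hs hs', S'.smul_shiftedTransfer j hs', step j ih, add_right_inj] at e
      exact e.symm
  exact ⟨hD, fun j => step j (all j)⟩

/-- A polynomial expression of the resolvent at a point where the annihilating polynomial `p`
does not vanish. -/
lemma resolvent_eq_aeval {k : ℕ} (A : Matrix (Fin k) (Fin k) ℂ) {s : ℂ} {p q : Polynomial ℂ}
    (hq : p - Polynomial.C (p.eval s) = (Polynomial.X - Polynomial.C s) * q)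
    (hA : Polynomial.aeval A p = 0) (hp : p.eval s ≠ 0) :
    (s • (1 : Matrix (Fin k) (Fin k) ℂ) - A)⁻¹ = (p.eval s)⁻¹ • Polynomial.aeval A q := by
  -- Evaluated at `A`, where `p` vanishes, the identity reads `-p(s) = (A - s) q(A)`, which exhibits
  -- the inverse.
  have h := congrArg (Polynomial.aeval A) hq
  simp only [map_sub, map_mul, hA, Polynomial.aeval_C, Polynomial.aeval_X,
    Algebra.algebraMap_eq_smul_one, zero_sub] at h
  apply Matrix.inv_eq_right_inv
  rw [mul_smul_comm, ← neg_sub A, neg_mul, ← h, neg_neg, smul_smul, inv_mul_cancel₀ hp, one_smul]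

lemma mul_aeval_mul (S : LTISystem n m) (q : Polynomial ℂ) :
    toComplexMatrix S.C * Polynomial.aeval (toComplexMatrix S.A) q * toComplexMatrix S.B
      = q.sum fun j c => c • toComplexMatrix (S.markov j) := by
  rw [Polynomial.aeval_eq_sum_range, Polynomial.sum_over_range _ (by simp)]
  simp [Matrix.mul_sum, Matrix.sum_mul, markov, toComplexMatrix_mul, toComplexMatrix_pow]

/-- At a fixed regular `s` both resolvents are the same polynomial, applied to `A` and to `A'`: the
product of the two characteristic polynomials annihilates both matrices. The transfer matrices are
then the same finite combination of Markov parameters, and no convergence is involved. -/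
lemma SameMarkov.sameTransfer {S : LTISystem n m} {S' : LTISystem n' m} (h : S.SameMarkov S') :
    S.SameTransfer S' := by
  intro s hs hs'
  set A := toComplexMatrix S.A with hA
  set A' := toComplexMatrix S'.A with hA'
  set p := A.charpoly * A'.charpoly with hp
  have e : ∀ {k : ℕ} (M : Matrix (Fin k) (Fin k) ℂ),
      IsUnit (s • (1 : Matrix (Fin k) (Fin k) ℂ) - M) → M.charpoly.eval s ≠ 0 := by
    intro k M hM
    rw [Matrix.eval_charpoly, Matrix.scalar_apply, ← Matrix.smul_one_eq_diagonal]
    exact ((Matrix.isUnit_iff_isUnit_det _).mp hM).ne_zero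
  have hps : p.eval s ≠ 0 := by
    rw [hp, Polynomial.eval_mul]
    exact mul_ne_zero (e _ hs) (e _ hs')
  obtain ⟨q, hq⟩ := Polynomial.X_sub_C_dvd_sub_C_eval (a := s) (p := p)
  have r := resolvent_eq_aeval A hq (by rw [hp, map_mul, Matrix.aeval_self_charpoly, zero_mul]) hps
  have r' := resolvent_eq_aeval A' hq (by rw [hp, map_mul, Matrix.aeval_self_charpoly, mul_zero])
    hps
  rw [transfer, transfer, ← hA, ← hA', r, r', Matrix.mul_smul, Matrix.mul_smul, Matrix.smul_mul,
    Matrix.smul_mul, mul_aeval_mul, mul_aeval_mul, h.1]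
  simp only [h.2]

/-! ### Minimality -/

lemma adjoint_markov (S : LTISystem n m) (j : ℕ) :
    S.adjoint.markov j = (-1 : ℝ) ^ (j + 1) • (S.markov j)ᵀ := by
  simp only [markov, adjoint]
  rw [← neg_one_smul ℝ S.Aᵀ, smul_pow, Matrix.mul_smul, Matrix.smul_mul, pow_succ]
  simp [Matrix.mul_assoc]

lemma SameMarkov.adjoint {S : LTISystem n m} {S' : LTISystem n' m} (h : S.SameMarkov S') :
    S.adjoint.SameMarkov S'.adjoint :=
  ⟨congrArg Matrix.transpose h.1, fun j => by rw [adjoint_markov, adjoint_markov, h.2]⟩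

lemma sameMarkov_adjoint_adjoint (S : LTISystem n m) : S.adjoint.adjoint.SameMarkov S := by
  refine ⟨by simp [LTISystem.adjoint], fun j => ?_⟩
  simp [markov, LTISystem.adjoint]

lemma SameMarkov.symm {S : LTISystem n m} {S' : LTISystem n' m} (h : S.SameMarkov S') :
    S'.SameMarkov S := ⟨h.1.symm, fun j => (h.2 j).symm⟩

lemma SameMarkov.trans {n'' : ℕ} {S : LTISystem n m} {S' : LTISystem n' m}
    {S'' : LTISystem n'' m} (h : S.SameMarkov S') (h' : S'.SameMarkov S'') :
    S.SameMarkov S'' := ⟨h.1.trans h'.1, fun j => (h.2 j).trans (h'.2 j)⟩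

/-- A smaller realization of the adjoint would have an adjoint that realizes the original transfer
matrix. -/
lemma IsMinimal.adjoint {S : LTISystem n m} (hS : S.IsMinimal) : S.adjoint.IsMinimal :=
  fun n' S' h => hS n' S'.adjoint
    ((sameMarkov_adjoint_adjoint S).symm.trans h.sameMarkov.adjoint).sameTransfer

/-- The subspace of unobservable states. -/
def unobservable (S : LTISystem n m) : Submodule ℝ (Fin n → ℝ) :=
  ⨅ j, LinearMap.ker (Matrix.mulVecLin (S.C * S.A ^ j))

lemma mem_unobservable (S : LTISystem n m) (x : Fin n → ℝ) :
    x ∈ S.unobservable ↔ ∀ j, (S.C * S.A ^ j) *ᵥ x = 0 := by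
  simp [unobservable]

/-- The system induced on the quotient of the state space by the unobservable states has the same
Markov parameters. -/
lemma exists_sameMarkov_quotient (S : LTISystem n m) :
    ∃ S' : LTISystem (Module.finrank ℝ ((Fin n → ℝ) ⧸ S.unobservable)) m, S.SameMarkov S' := by
  set N := S.unobservable
  set b := Module.finBasis ℝ ((Fin n → ℝ) ⧸ N)
  have hA : N ≤ N.comap (Matrix.toLin' S.A) := by
    intro x hx
    rw [Submodule.mem_comap, mem_unobservable]
    intro j
    have := (S.mem_unobservable x).mp hx (j + 1)
    rwa [pow_succ, ← Matrix.mul_assoc, ← Matrix.mulVec_mulVec] at this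
  have hC : N ≤ LinearMap.ker (Matrix.toLin' S.C) := by
    intro x hx
    simpa using (S.mem_unobservable x).mp hx 0
  let A' := N.mapQ N (Matrix.toLin' S.A) hA
  let C' := N.liftQ (Matrix.toLin' S.C) hC
  let B' := N.mkQ ∘ₗ Matrix.toLin' S.B
  let e := Pi.basisFun ℝ (Fin m)
  refine ⟨⟨LinearMap.toMatrix b b A', LinearMap.toMatrix e b B', LinearMap.toMatrix b e C', S.D⟩,
    rfl, fun j => ?_⟩
  -- The projection intertwines the powers of `A` and `A'`, so `C' A'ʲ B'` collapses to `C Aʲ B`.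
  have hpow : (A' ^ j) ∘ₗ N.mkQ = N.mkQ ∘ₗ (Matrix.toLin' S.A ^ j) := by
    induction j with
    | zero => rfl
    | succ j ih =>
      rw [pow_succ, Module.End.mul_eq_comp, LinearMap.comp_assoc,
        show A' ∘ₗ N.mkQ = N.mkQ ∘ₗ Matrix.toLin' S.A from Submodule.mapQ_mkQ _ _ _,
        ← LinearMap.comp_assoc, ih, LinearMap.comp_assoc, ← Module.End.mul_eq_comp, ← pow_succ]
  have hlin : C' ∘ₗ (A' ^ j) ∘ₗ B' = Matrix.toLin' (S.C * S.A ^ j * S.B) := by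
    refine LinearMap.ext fun x => ?_
    have h := LinearMap.congr_fun hpow (Matrix.toLin' S.B x)
    rw [← Matrix.toLin'_pow] at h
    change C' ((A' ^ j) (N.mkQ (Matrix.toLin' S.B x))) = _
    rw [show (A' ^ j) (N.mkQ (Matrix.toLin' S.B x)) = _ from h]
    simp [C']
  have : LinearMap.toMatrix e e (C' ∘ₗ (A' ^ j) ∘ₗ B') = S.C * S.A ^ j * S.B := by
    rw [hlin]
    exact LinearMap.toMatrix'_toLin' _
  rw [markov, ← this, LinearMap.toMatrix_comp e b e, LinearMap.toMatrix_comp e b b,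
    ← LinearMap.toMatrix_pow, markov, Matrix.mul_assoc]

/-- The quotient by the unobservable states realizes the same transfer matrix, so minimality
prevents its dimension from dropping. -/
lemma IsMinimal.isObservable {S : LTISystem n m} (hS : S.IsMinimal) : S.IsObservable := by
  obtain ⟨S', h⟩ := S.exists_sameMarkov_quotient
  have h1 := hS _ S' h.sameTransfer
  have h2 := S.unobservable.finrank_quotient_add_finrank
  rw [Module.finrank_fin_fun] at h2
  have h3 : S.unobservable = ⊥ := Submodule.finrank_eq_zero.mp (by omega)
  intro x hx
  have : x ∈ S.unobservable := (S.mem_unobservable x).mpr fun j => by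
    rw [← Matrix.mulVec_mulVec, hx j]
  rwa [h3, Submodule.mem_bot] at this

end LTISystem

/-! ### The matrix exponential. -/

/-- The one-parameter group `e^{tA}` generated by a matrix. -/
noncomputable def expm {k : ℕ} (A : Matrix (Fin k) (Fin k) ℝ) (t : ℝ) :
    Matrix (Fin k) (Fin k) ℝ := NormedSpace.exp (t • A)

section MatrixExponential

variable {k l r : ℕ} (A : Matrix (Fin k) (Fin k) ℝ)

lemma expm_zero : expm A 0 = 1 := by simp [expm]

lemma expm_add (s t : ℝ) : expm A (s + t) = expm A s * expm A t := by
  rw [expm, add_smul]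
  exact Matrix.exp_add_of_commute _ _ ((Commute.refl A).smul_left s |>.smul_right t)

lemma expm_neg_mul_self (t : ℝ) : expm A (-t) * expm A t = 1 := by
  rw [← expm_add, neg_add_cancel, expm_zero]

lemma expm_mul_neg_self (t : ℝ) : expm A t * expm A (-t) = 1 := by
  rw [← expm_add, add_neg_cancel, expm_zero]

lemma expm_transpose (t : ℝ) : expm Aᵀ t = (expm A t)ᵀ := by
  rw [expm, expm, ← Matrix.exp_transpose, Matrix.transpose_smul]

lemma expm_neg_matrix (t : ℝ) : expm (-A) t = expm A (-t) := by
  rw [expm, expm, smul_neg, neg_smul]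

/-- The entrywise form keeps the statement independent of a choice of matrix norm, which stays local
to the proof. -/
lemma hasDerivAt_expm_apply (t : ℝ) (i j : Fin k) :
    HasDerivAt (fun t => expm A t i j) ((expm A t * A) i j) t := by
  let _ : NormedRing (Matrix (Fin k) (Fin k) ℝ) := Matrix.linftyOpNormedRing
  let _ : NormedAlgebra ℝ (Matrix (Fin k) (Fin k) ℝ) := Matrix.linftyOpNormedAlgebra
  have h : HasDerivAt (fun t => expm A t) (expm A t * A) t := hasDerivAt_exp_smul_const A t
  exact (LinearMap.toContinuousLinearMap (Matrix.entryLinearMap ℝ ℝ i j)).hasFDerivAt.comp_hasDerivAt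
    t h

lemma commute_expm (t : ℝ) : expm A t * A = A * expm A t := by
  let _ : NormedRing (Matrix (Fin k) (Fin k) ℝ) := Matrix.linftyOpNormedRing
  let _ : NormedAlgebra ℝ (Matrix (Fin k) (Fin k) ℝ) := Matrix.linftyOpNormedAlgebra
  let _ : NormedAlgebra ℚ (Matrix (Fin k) (Fin k) ℝ) := NormedAlgebra.restrictScalars ℚ ℝ _
  exact (((Commute.refl A).smul_left t).exp_left).eq

lemma continuous_expm : Continuous (expm A) :=
  continuous_matrix fun i j =>
    continuous_iff_continuousAt.mpr fun t => (hasDerivAt_expm_apply A t i j).continuousAt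

lemma hasSum_expm (t : ℝ) :
    HasSum (fun j : ℕ => (t ^ j / (j.factorial : ℝ)) • A ^ j) (expm A t) := by
  let _ : NormedRing (Matrix (Fin k) (Fin k) ℝ) := Matrix.linftyOpNormedRing
  let _ : NormedAlgebra ℝ (Matrix (Fin k) (Fin k) ℝ) := Matrix.linftyOpNormedAlgebra
  have h := NormedSpace.exp_series_hasSum_exp' (𝕂 := ℝ) (t • A)
  refine h.congr_fun fun j => ?_
  rw [smul_pow, smul_smul, div_eq_inv_mul]

lemma hasDerivAt_mulVec_expm (M : Matrix (Fin l) (Fin k) ℝ) (x : Fin k → ℝ) (t : ℝ) :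
    HasDerivAt (fun t => M *ᵥ (expm A t *ᵥ x)) ((M * A) *ᵥ (expm A t *ᵥ x)) t := by
  have h : HasDerivAt (fun t => expm A t *ᵥ x) ((expm A t * A) *ᵥ x) t := by
    refine hasDerivAt_pi.mpr fun i => ?_
    simp only [Matrix.mulVec, dotProduct]
    exact HasDerivAt.fun_sum fun j _ => (hasDerivAt_expm_apply A t i j).mul_const _
  have h2 := (LinearMap.toContinuousLinearMap M.mulVecLin).hasFDerivAt.comp_hasDerivAt t h
  rw [commute_expm] at h2
  simpa [Function.comp_def, Matrix.mulVec_mulVec, Matrix.mul_assoc] using h2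

/-- Two observed exponentials that agree on an open set have all their derivatives in common. -/
lemma mulVec_pow_expm_eqOn {A' : Matrix (Fin r) (Fin r) ℝ} {C : Matrix (Fin l) (Fin k) ℝ}
    {C' : Matrix (Fin l) (Fin r) ℝ} {x : Fin k → ℝ} {x' : Fin r → ℝ} {U : Set ℝ} (hU : IsOpen U)
    (h : ∀ t ∈ U, C *ᵥ (expm A t *ᵥ x) = C' *ᵥ (expm A' t *ᵥ x')) (j : ℕ) :
    ∀ t ∈ U, (C * A ^ j) *ᵥ (expm A t *ᵥ x) = (C' * A' ^ j) *ᵥ (expm A' t *ᵥ x') := by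
  induction j with
  | zero => simpa using h
  | succ j ih =>
    intro t ht
    have h1 := hasDerivAt_mulVec_expm A (C * A ^ j) x t
    have h2 := hasDerivAt_mulVec_expm A' (C' * A' ^ j) x' t
    rw [pow_succ, pow_succ, ← Matrix.mul_assoc, ← Matrix.mul_assoc]
    refine h1.unique (h2.congr_of_eventuallyEq ?_)
    filter_upwards [hU.mem_nhds ht] with s hs using ih s hs

end MatrixExponential

/-! ### Product rules for integrated derivatives -/

/-- The product rule for two functions given as integrals of their derivatives. -/
lemma mul_sub_mul_eq_integral {f g f' g' : ℝ → ℝ} (hf' : ∀ a b, IntervalIntegrable f' volume a b)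
    (hg' : ∀ a b, IntervalIntegrable g' volume a b) (hf : ∀ a b, f b - f a = ∫ t in a..b, f' t)
    (hg : ∀ a b, g b - g a = ∫ t in a..b, g' t) (a b : ℝ) :
    f b * g b - f a * g a = ∫ t in a..b, (f' t * g t + f t * g' t) := by
  -- An indefinite integral is absolutely continuous and has the integrand as derivative almost
  -- everywhere; integration by parts for absolutely continuous functions then applies.
  have key : ∀ {f f' : ℝ → ℝ}, (∀ a b, IntervalIntegrable f' volume a b) →
      (∀ a b, f b - f a = ∫ t in a..b, f' t) → AbsolutelyContinuousOnInterval f a b ∧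
        ∀ᵐ t, t ∈ Set.uIcc a b → HasDerivAt f (f' t) t := by
    intro f f' hf' hf
    have e : f = fun t => f a + ∫ s in a..t, f' s := by
      funext t; rw [← hf]; ring
    constructor
    · have hc : AbsolutelyContinuousOnInterval (fun _ : ℝ => f a) a b :=
        (LipschitzWith.const (f a)).lipschitzOnWith.absolutelyContinuousOnInterval
      rw [e]
      exact hc.add ((hf' a b).absolutelyContinuousOnInterval_intervalIntegral (c := a) (by simp))
    · filter_upwards [(hf' a b).ae_hasDerivAt_integral] with t ht htm
      have := (ht htm a (by simp)).const_add (f a)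
      rw [e]
      exact this
  obtain ⟨af, df⟩ := key hf' hf
  obtain ⟨ag, dg⟩ := key hg' hg
  rw [← af.integral_deriv_mul_eq_sub ag]
  refine intervalIntegral.integral_congr_ae ?_
  filter_upwards [df, dg] with t h1 h2 ht
  have ht := Set.uIoc_subset_uIcc ht
  rw [(h1 ht).deriv, (h2 ht).deriv]

lemma intervalIntegral_apply {k : ℕ} {f : ℝ → Fin k → ℝ} {a b : ℝ}
    (hf : IntervalIntegrable f volume a b) (i : Fin k) :
    (∫ t in a..b, f t) i = ∫ t in a..b, f t i :=
  ((ContinuousLinearMap.proj (R := ℝ) (φ := fun _ : Fin k => ℝ) i).intervalIntegral_comp_comm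
    hf).symm

lemma IntervalIntegrable.pi_apply {k : ℕ} {f : ℝ → Fin k → ℝ} {a b : ℝ}
    (hf : IntervalIntegrable f volume a b) (i : Fin k) :
    IntervalIntegrable (fun t => f t i) volume a b :=
  ⟨(ContinuousLinearMap.proj (R := ℝ) (φ := fun _ : Fin k => ℝ) i).integrable_comp hf.1,
    (ContinuousLinearMap.proj (R := ℝ) (φ := fun _ : Fin k => ℝ) i).integrable_comp hf.2⟩

/-- The product rule for the dot product of two vector functions given as integrals of their
derivatives. -/
lemma dotProduct_sub_eq_integral {k : ℕ} {f g f' g' : ℝ → Fin k → ℝ}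
    (hf' : ∀ a b, IntervalIntegrable f' volume a b)
    (hg' : ∀ a b, IntervalIntegrable g' volume a b) (hf : ∀ a b, f b - f a = ∫ t in a..b, f' t)
    (hg : ∀ a b, g b - g a = ∫ t in a..b, g' t) (hfc : Continuous f) (hgc : Continuous g)
    (a b : ℝ) :
    f b ⬝ᵥ g b - f a ⬝ᵥ g a = ∫ t in a..b, (f' t ⬝ᵥ g t + f t ⬝ᵥ g' t) := by
  simp only [dotProduct, ← Finset.sum_sub_distrib, ← Finset.sum_add_distrib]
  rw [intervalIntegral.integral_finsetSum]
  · refine Finset.sum_congr rfl fun i _ => ?_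
    refine mul_sub_mul_eq_integral (f := fun t => f t i) (g := fun t => g t i)
      (fun a b => (hf' a b).pi_apply i)
      (fun a b => (hg' a b).pi_apply i) (fun a b => ?_) (fun a b => ?_) a b
    · rw [← intervalIntegral_apply (hf' a b), ← hf]; rfl
    · rw [← intervalIntegral_apply (hg' a b), ← hg]; rfl
  · intro i _
    exact (((hf' a b).pi_apply i).mul_continuousOn
      ((continuous_apply i).comp hgc).continuousOn).add
      (((hg' a b).pi_apply i).continuousOn_mul ((continuous_apply i).comp hfc).continuousOn)

/-- The product rule for a continuously differentiable matrix function applied to a vector function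
given as the integral of its derivative. -/
lemma mulVec_sub_eq_integral {k l : ℕ} {F F' : ℝ → Matrix (Fin l) (Fin k) ℝ} {g g' : ℝ → Fin k → ℝ}
    (hF : ∀ i j t, HasDerivAt (fun t => F t i j) (F' t i j) t) (hF' : Continuous F')
    (hg' : ∀ a b, IntervalIntegrable g' volume a b) (hg : ∀ a b, g b - g a = ∫ t in a..b, g' t)
    (hgc : Continuous g) (a b : ℝ) :
    F b *ᵥ g b - F a *ᵥ g a = ∫ t in a..b, (F' t *ᵥ g t + F t *ᵥ g' t) := by
  have hFc : Continuous F := continuous_matrix fun i j =>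
    continuous_iff_continuousAt.mpr fun t => (hF i j t).continuousAt
  have hint : IntervalIntegrable (fun t => F' t *ᵥ g t + F t *ᵥ g' t) volume a b := by
    refine ((hF'.matrix_mulVec hgc).intervalIntegrable a b).add ?_
    rw [intervalIntegrable_iff]
    refine Integrable.of_eval fun i => ?_
    simp only [Matrix.mulVec, dotProduct]
    refine integrable_finsetSum _ fun j _ => ?_
    exact (intervalIntegrable_iff.mp (((hg' a b).pi_apply j).continuousOn_mul
      (hFc.matrix_elem i j).continuousOn))
  funext i
  rw [intervalIntegral_apply hint]
  have hrow : ∀ a b, F b i - F a i = ∫ t in a..b, F' t i := by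
    intro a b
    have hc : Continuous fun t => F' t i := (continuous_apply i).comp hF'
    refine (intervalIntegral.integral_eq_sub_of_hasDerivAt (f := fun t => F t i)
      (fun t _ => hasDerivAt_pi.mpr fun j => hF i j t) (hc.intervalIntegrable a b)).symm
  exact dotProduct_sub_eq_integral
    (fun a b => ((continuous_apply i).comp hF').intervalIntegrable a b) hg' hrow hg
    ((continuous_apply i).comp hFc) hgc a b

/-! ### Impulse responses and Markov parameters -/

namespace LTISystem

variable {n n' m : ℕ}

lemma impulse_eq_expm (S : LTISystem n m) (t : ℝ) : S.impulse t = S.C * expm S.A t * S.B := rfl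

lemma hasSum_impulse (S : LTISystem n m) (t : ℝ) :
    HasSum (fun j : ℕ => (t ^ j / (j.factorial : ℝ)) • S.markov j) (S.impulse t) := by
  let L : Matrix (Fin n) (Fin n) ℝ →+ Matrix (Fin m) (Fin m) ℝ :=
    AddMonoidHom.mk' (fun M => S.C * M * S.B) fun M N => by rw [Matrix.mul_add, Matrix.add_mul]
  have hL : Continuous L := by
    change Continuous fun M : Matrix (Fin n) (Fin n) ℝ => S.C * M * S.B
    fun_prop
  refine ((hasSum_expm S.A t).map L hL).congr_fun fun j => ?_
  simp [L, markov]

lemma SameMarkov.impulse_eq {S : LTISystem n m} {S' : LTISystem n' m} (h : S.SameMarkov S')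
    (t : ℝ) : S.impulse t = S'.impulse t := by
  refine (S.hasSum_impulse t).unique ?_
  simp only [h.2]
  exact S'.hasSum_impulse t

/-- The Markov parameters are the derivatives of the impulse response at `0`. Equality of
derivatives holds on the open interval and passes to its endpoint by continuity. -/
lemma markov_eq_of_impulse_eqOn {S : LTISystem n m} {S' : LTISystem n' m}
    (h : ∀ t ∈ Set.Ioo (0 : ℝ) 1, S.impulse t = S'.impulse t) (j : ℕ) :
    S.markov j = S'.markov j := by
  refine Matrix.ext_of_mulVec_single fun i => ?_
  set v : Fin m → ℝ := Pi.single i 1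
  have h1 := mulVec_pow_expm_eqOn S.A (A' := S'.A) (C := S.C) (C' := S'.C) (x := S.B *ᵥ v)
    (x' := S'.B *ᵥ v) isOpen_Ioo (fun t ht => by
      have := congrArg (fun M => M *ᵥ v) (h t ht)
      simpa [impulse_eq_expm, Matrix.mulVec_mulVec, Matrix.mul_assoc] using this) j
  have hc : ∀ {k : ℕ} (T : LTISystem k m),
      Continuous fun t => (T.C * T.A ^ j) *ᵥ (expm T.A t *ᵥ (T.B *ᵥ v)) := fun T =>
    continuous_const.matrix_mulVec ((continuous_expm _).matrix_mulVec continuous_const)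
  have h2 := Set.EqOn.closure (s := Set.Ioo (0 : ℝ) 1) h1 (hc S) (hc S')
  rw [closure_Ioo (by norm_num)] at h2
  have h3 := h2 (Set.left_mem_Icc.mpr zero_le_one)
  simpa [expm_zero, markov, Matrix.mulVec_mulVec, Matrix.mul_assoc] using h3

/-- An observable state whose free output vanishes on a nonempty open set is zero. -/
lemma IsObservable.eq_zero {S : LTISystem n m} (hS : S.IsObservable) {U : Set ℝ} (hU : IsOpen U)
    (hne : U.Nonempty) {x : Fin n → ℝ} (h : ∀ t ∈ U, S.C *ᵥ (expm S.A t *ᵥ x) = 0) : x = 0 := by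
  obtain ⟨t, ht⟩ := hne
  have h1 := mulVec_pow_expm_eqOn S.A (A' := S.A) (C := S.C) (C' := S.C) (x := x) (x' := 0) hU
    (fun t ht => by rw [h t ht]; simp)
  have h2 : expm S.A t *ᵥ x = 0 := hS _ fun j => by
    rw [Matrix.mulVec_mulVec, h1 j t ht]; simp
  have h3 := congrArg (fun y => expm S.A (-t) *ᵥ y) h2
  simpa [Matrix.mulVec_mulVec, expm_neg_mul_self] using h3

/-- If the free output vanishes almost everywhere on a nonempty open set, the state is zero. -/
lemma IsObservable.eq_zero_of_ae {S : LTISystem n m} (hS : S.IsObservable) {U : Set ℝ}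
    (hU : IsOpen U) (hne : U.Nonempty) {x : Fin n → ℝ}
    (h : ∀ᵐ t : ℝ, t ∈ U → S.C *ᵥ (expm S.A t *ᵥ x) = 0) : x = 0 := by
  refine hS.eq_zero hU hne ?_
  have hc : Continuous fun t => S.C *ᵥ (expm S.A t *ᵥ x) :=
    continuous_const.matrix_mulVec ((continuous_expm _).matrix_mulVec continuous_const)
  have h' : (fun t => S.C *ᵥ (expm S.A t *ᵥ x)) =ᵐ[volume.restrict U] fun _ => 0 :=
    (ae_restrict_iff' hU.measurableSet).mpr h
  exact Measure.eqOn_open_of_ae_eq h' hU hc.continuousOn continuousOn_const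

end LTISystem

/-! ### State trajectories from rest and the graph of the Volterra operator. -/

lemma CSignal.exists_ae_eq_zero {m : ℕ} (u : CSignal m) :
    ∃ R : ℝ, ∀ᵐ t : ℝ, R < |t| → (u.1 t).ofLp = 0 := by
  obtain ⟨R, hR⟩ := u.2
  refine ⟨R, ?_⟩
  filter_upwards [hR] with t h ht
  rw [h ht, WithLp.ofLp_zero]

namespace LTISystem

variable {n m : ℕ}

/-- `x` satisfies the state equation `ẋ = A x + B u` in integrated form. -/
def IsStateTrajectory (S : LTISystem n m) (x : ℝ → Fin n → ℝ) (u : CSignal m) : Prop :=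
  Continuous x ∧ ∀ a b : ℝ, x b - x a = ∫ t in a..b, (S.A *ᵥ x t + S.B *ᵥ (u.1 t).ofLp)

/-- The kernel `e^{-tA} B`. -/
noncomputable def reachKernel (S : LTISystem n m) (t : ℝ) : Matrix (Fin n) (Fin m) ℝ :=
  expm S.A (-t) * S.B

lemma continuous_reachKernel (S : LTISystem n m) : Continuous S.reachKernel :=
  ((continuous_expm S.A).comp continuous_neg).matrix_mul continuous_const

/-- The state reached from rest at `-∞`, transported back to time zero. -/
noncomputable def reach (S : LTISystem n m) (u : CSignal m) (t : ℝ) : Fin n → ℝ :=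
  ∫ τ in Set.Iic t, S.reachKernel τ *ᵥ (u.1 τ).ofLp

/-- The state trajectory starting from rest at `-∞`. -/
noncomputable def state (S : LTISystem n m) (u : CSignal m) (t : ℝ) : Fin n → ℝ :=
  expm S.A t *ᵥ S.reach u t

lemma integrable_reachKernel (S : LTISystem n m) (u : CSignal m) :
    Integrable fun t => S.reachKernel t *ᵥ (u.1 t).ofLp :=
  u.integrable_mulVec _ S.continuous_reachKernel

lemma reach_sub_reach (S : LTISystem n m) (u : CSignal m) (a b : ℝ) :
    S.reach u b - S.reach u a = ∫ t in a..b, S.reachKernel t *ᵥ (u.1 t).ofLp :=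
  intervalIntegral.integral_Iic_sub_Iic (S.integrable_reachKernel u).integrableOn
    (S.integrable_reachKernel u).integrableOn

lemma continuous_reach (S : LTISystem n m) (u : CSignal m) : Continuous (S.reach u) := by
  have h : S.reach u = fun t => S.reach u 0 + ∫ τ in (0 : ℝ)..t, S.reachKernel τ *ᵥ (u.1 τ).ofLp := by
    funext t
    rw [← reach_sub_reach]; abel
  rw [h]
  exact continuous_const.add (intervalIntegral.continuous_primitive
    (fun a b => (S.integrable_reachKernel u).intervalIntegrable) 0)

lemma continuous_state (S : LTISystem n m) (u : CSignal m) : Continuous (S.state u) :=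
  (continuous_expm S.A).matrix_mulVec (S.continuous_reach u)

lemma isStateTrajectory_expm (S : LTISystem n m) (u : CSignal m) {ξ : ℝ → Fin n → ℝ}
    (hc : Continuous ξ)
    (hξ : ∀ a b, ξ b - ξ a = ∫ t in a..b, S.reachKernel t *ᵥ (u.1 t).ofLp) :
    S.IsStateTrajectory (fun t => expm S.A t *ᵥ ξ t) u := by
  refine ⟨(continuous_expm S.A).matrix_mulVec hc, fun a b => ?_⟩
  rw [mulVec_sub_eq_integral (fun i j t => hasDerivAt_expm_apply S.A t i j)
    ((continuous_expm S.A).matrix_mul continuous_const)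
    (fun a b => (S.integrable_reachKernel u).intervalIntegrable) hξ hc a b]
  refine intervalIntegral.integral_congr fun t _ => ?_
  simp only [reachKernel, Matrix.mulVec_mulVec, ← Matrix.mul_assoc, expm_mul_neg_self,
    commute_expm, Matrix.one_mul]

lemma isStateTrajectory_state (S : LTISystem n m) (u : CSignal m) :
    S.IsStateTrajectory (S.state u) u :=
  S.isStateTrajectory_expm u (S.continuous_reach u) (S.reach_sub_reach u)

/-- Variation of constants. -/
lemma IsStateTrajectory.expm_neg_sub {S : LTISystem n m} {x : ℝ → Fin n → ℝ} {u : CSignal m}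
    (h : S.IsStateTrajectory x u) (a b : ℝ) :
    expm S.A (-b) *ᵥ x b - expm S.A (-a) *ᵥ x a
      = ∫ t in a..b, S.reachKernel t *ᵥ (u.1 t).ofLp := by
  -- In the derivative of `e^{-tA} x` the two terms with `A x` cancel.
  have hd : ∀ i j t, HasDerivAt (fun t => expm S.A (-t) i j) ((-(expm S.A (-t) * S.A)) i j) t := by
    intro i j t
    have := hasDerivAt_expm_apply (-S.A) t i j
    simpa only [expm_neg_matrix, Matrix.mul_neg] using this
  rw [mulVec_sub_eq_integral hd
    (((continuous_expm S.A).comp continuous_neg).matrix_mul continuous_const).neg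
    (fun a b => S.intervalIntegrable_rhs h.1 u a b) h.2 h.1 a b]
  refine intervalIntegral.integral_congr fun t _ => ?_
  simp only [reachKernel, Matrix.mulVec_mulVec, Matrix.mulVec_add, Matrix.neg_mulVec]
  abel

/-- The splitting `e^{A(t-τ)} = e^{At} e^{-Aτ}` turns the convolution into the output of the state
that starts from rest. -/
lemma volterraOutput_eq (S : LTISystem n m) (u : CSignal m) (t : ℝ) :
    S.volterraOutput u t = S.C *ᵥ S.state u t + S.D *ᵥ (u.1 t).ofLp := by
  rw [volterraOutput, state, reach, Matrix.mulVec_mulVec]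
  congr 1
  have h := (LinearMap.toContinuousLinearMap (S.C * expm S.A t).mulVecLin).integral_comp_comm
    (S.integrable_reachKernel u).integrableOn (μ := volume.restrict (Set.Iic t))
  refine Eq.trans ?_ h
  refine integral_congr_ae (Filter.Eventually.of_forall fun τ => ?_)
  simp only [impulse_eq_expm, reachKernel, sub_eq_add_neg, expm_add,
    LinearMap.coe_toContinuousLinearMap',
    Matrix.mulVecLin_apply, Matrix.mulVec_mulVec, Matrix.mul_assoc]

lemma reach_eq_zero (S : LTISystem n m) {u : CSignal m} {R t : ℝ}
    (hu : ∀ᵐ t : ℝ, R < |t| → (u.1 t).ofLp = 0) (ht : t < -R) : S.reach u t = 0 := by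
  refine setIntegral_eq_zero_of_ae_eq_zero ?_
  filter_upwards [hu] with τ h hτ
  rw [h (lt_abs.mpr (Or.inr (by linarith [Set.mem_Iic.mp hτ]))), Matrix.mulVec_zero]

/-- The state reached from rest at the end of the support of the input, transported back to time
zero. -/
noncomputable def terminal (S : LTISystem n m) (u : CSignal m) : Fin n → ℝ :=
  ∫ τ, S.reachKernel τ *ᵥ (u.1 τ).ofLp

lemma reach_eq_terminal (S : LTISystem n m) {u : CSignal m} {R t : ℝ}
    (hu : ∀ᵐ t : ℝ, R < |t| → (u.1 t).ofLp = 0) (ht : R < t) : S.reach u t = S.terminal u := by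
  refine setIntegral_eq_integral_of_ae_compl_eq_zero ?_
  filter_upwards [hu] with τ h hτ
  rw [h (lt_abs.mpr (Or.inl (by linarith [not_le.mp (fun hc => hτ (Set.mem_Iic.mpr hc))]))),
    Matrix.mulVec_zero]

/-- For an observable system, the trajectories with input and output of compact support start from
rest. -/
lemma IsTrajectory.eq_state {S : LTISystem n m} (hS : S.IsObservable) {x : ℝ → Fin n → ℝ}
    {u y : CSignal m} (h : S.IsTrajectory x u y) : x = S.state u := by
  obtain ⟨R₁, hu⟩ := u.exists_ae_eq_zero
  obtain ⟨R₂, hy⟩ := y.exists_ae_eq_zero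
  set R := max R₁ R₂
  have hx : S.IsStateTrajectory x u := ⟨h.1, h.2.1⟩
  set z : ℝ → Fin n → ℝ := fun t => expm S.A (-t) *ᵥ x t with hz
  have hzx : ∀ t, x t = expm S.A t *ᵥ z t := fun t => by
    rw [hz, Matrix.mulVec_mulVec, expm_mul_neg_self, Matrix.one_mulVec]
  -- By variation of constants `z` and `reach u` differ by a constant. It is the only freedom left
  -- in `x`, and observability before the supports of `u` and `y` removes it.
  set c := z 0 - S.reach u 0 with hc
  have hconst : ∀ t, z t = c + S.reach u t := fun t => by
    have h1 := (hx.expm_neg_sub 0 t).trans (S.reach_sub_reach u 0 t).symm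
    change z t - z 0 = _ at h1
    rw [hc, ← sub_eq_zero, ← sub_eq_zero.mpr h1]; abel
  have hc0 : c = 0 := by
    refine hS.eq_zero_of_ae (U := Set.Iio (-R)) isOpen_Iio Set.nonempty_Iio ?_
    filter_upwards [h.2.2, hu, hy] with t ht hut hyt htR
    have h1 : R₁ < |t| := lt_abs.mpr (Or.inr (by
      linarith [Set.mem_Iio.mp htR, le_max_left R₁ R₂]))
    have h2 : R₂ < |t| := lt_abs.mpr (Or.inr (by
      linarith [Set.mem_Iio.mp htR, le_max_right R₁ R₂]))
    have h3 : S.reach u t = 0 :=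
      S.reach_eq_zero hu (by linarith [Set.mem_Iio.mp htR, le_max_left R₁ R₂])
    rw [hut h1, hyt h2, Matrix.mulVec_zero, add_zero, hzx, hconst, h3, add_zero] at ht
    exact ht.symm
  funext t
  rw [hzx, hconst, hc0, zero_add, state]

/-- The compact support behavior of an observable system is the graph of the restricted Volterra
operator. -/
lemma mem_compactBehavior_iff {S : LTISystem n m} (hS : S.IsObservable) {u y : CSignal m} :
    (u, y) ∈ S.compactBehavior ↔ S.IsVolterraOutput u y := by
  constructor
  · rintro ⟨x, hx⟩
    have e := hx.eq_state hS
    filter_upwards [hx.2.2] with t ht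
    rw [volterraOutput_eq, ← e]
    exact ht
  · intro h
    refine ⟨S.state u, S.continuous_state u, (S.isStateTrajectory_state u).2, ?_⟩
    filter_upwards [h] with t ht
    rw [← volterraOutput_eq]
    exact ht

/-- After the supports of `u` and `y` the output is the free output of the terminal state; it
vanishes, so observability applies. -/
lemma IsVolterraOutput.terminal_eq_zero {S : LTISystem n m} (hS : S.IsObservable)
    {u y : CSignal m} (h : S.IsVolterraOutput u y) : S.terminal u = 0 := by
  obtain ⟨R₁, hu⟩ := u.exists_ae_eq_zero
  obtain ⟨R₂, hy⟩ := y.exists_ae_eq_zero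
  refine hS.eq_zero_of_ae (U := Set.Ioi (max R₁ R₂)) isOpen_Ioi Set.nonempty_Ioi ?_
  filter_upwards [h, hu, hy] with t ht hut hyt htR
  obtain ⟨h1, h2⟩ := max_lt_iff.mp (Set.mem_Ioi.mp htR)
  rw [volterraOutput_eq, hut (lt_abs.mpr (Or.inl h1)), hyt (lt_abs.mpr (Or.inl h2)),
    Matrix.mulVec_zero, add_zero, state, S.reach_eq_terminal hu h1] at ht
  exact ht.symm

/-- If the state returns to rest, it has compact support. -/
lemma state_eq_zero (S : LTISystem n m) {u : CSignal m} {R t : ℝ}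
    (hu : ∀ᵐ t : ℝ, R < |t| → (u.1 t).ofLp = 0) (h : S.terminal u = 0) (ht : R < |t|) :
    S.state u t = 0 := by
  rw [state]
  rcases lt_abs.mp ht with h1 | h1
  · rw [S.reach_eq_terminal hu h1, h, Matrix.mulVec_zero]
  · rw [S.reach_eq_zero hu (by linarith), Matrix.mulVec_zero]

/-- With zero terminal state the state has compact support and is continuous, so `C x` is square
integrable with compact support. -/
lemma exists_isVolterraOutput (S : LTISystem n m) {u : CSignal m} (h : S.terminal u = 0) :
    ∃ y, S.IsVolterraOutput u y := by
  obtain ⟨R, hu⟩ := u.exists_ae_eq_zero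
  set f : ℝ → EuclideanSpace ℝ (Fin m) := fun t => WithLp.toLp 2 (S.C *ᵥ S.state u t) with hf
  have hfc : Continuous f :=
    (PiLp.continuous_toLp 2 _).comp (continuous_const.matrix_mulVec (S.continuous_state u))
  have hf0 : ∀ t, R < |t| → f t = 0 := fun t ht => by
    simp only [hf]
    rw [S.state_eq_zero hu h ht, Matrix.mulVec_zero, WithLp.toLp_zero]
  have hsupp : HasCompactSupport f := by
    refine HasCompactSupport.intro (isCompact_Icc (a := -R) (b := R)) fun t ht => hf0 t ?_
    by_contra hc
    exact ht (abs_le.mp (not_lt.mp hc))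
  have hmem : MemLp f 2 volume := hfc.memLp_of_hasCompactSupport hsupp
  have hcs : hmem.toLp f ∈ compactSignals m := ⟨R, by
    filter_upwards [hmem.coeFn_toLp] with t e ht
    rw [e, hf0 t ht]⟩
  refine ⟨⟨hmem.toLp f, hcs⟩ + matrixAct S.D u, ?_⟩
  filter_upwards [hmem.coeFn_toLp, matrixAct_ae S.D u,
    CSignal.add_ae ⟨hmem.toLp f, hcs⟩ (matrixAct S.D u)] with t e1 e2 e3
  rw [e3, WithLp.ofLp_add, e2, volterraOutput_eq, e1]

end LTISystem

/-! ### Pairings of signals and test signals. -/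

namespace CSignal

variable {m : ℕ}

lemma inner_eq_integral (u v : CSignal m) :
    inner ℝ u v = ∫ t, (u.1 t).ofLp ⬝ᵥ (v.1 t).ofLp := by
  rw [Submodule.coe_inner, L2.inner_def]
  refine integral_congr_ae (Filter.Eventually.of_forall fun t => ?_)
  simp [EuclideanSpace.inner_eq_star_dotProduct, dotProduct_comm]

lemma integrable_dotProduct (u v : CSignal m) :
    Integrable fun t => (u.1 t).ofLp ⬝ᵥ (v.1 t).ofLp := by
  refine (L2.integrable_inner (𝕜 := ℝ) u.1 v.1).congr (Filter.Eventually.of_forall fun t => ?_)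
  simp [EuclideanSpace.inner_eq_star_dotProduct, dotProduct_comm]

lemma integrable_dotProduct_continuous (u : CSignal m) {q : ℝ → Fin m → ℝ} (hq : Continuous q) :
    Integrable fun t => (u.1 t).ofLp ⬝ᵥ q t := by
  -- The dot product with `q` is the action of a matrix function with the single row `q`.
  have hF : Continuous fun t => (Matrix.of fun _ : Fin 1 => q t) :=
    continuous_matrix fun _ j => (continuous_apply j).comp hq
  refine ((u.integrable_mulVec _ hF).eval 0).congr (Filter.Eventually.of_forall fun t => ?_)
  exact dotProduct_comm _ _

/-- The constant vector `v` on a bounded measurable set, as a signal of compact support. -/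
noncomputable def indicator (s : Set ℝ) (hs : MeasurableSet s) (hb : Bornology.IsBounded s)
    (v : Fin m → ℝ) : CSignal m :=
  ⟨indicatorConstLp 2 hs hb.measure_lt_top.ne (WithLp.toLp 2 v), by
    obtain ⟨R, hR⟩ := isBounded_iff_forall_norm_le.mp hb
    refine ⟨R, ?_⟩
    filter_upwards [indicatorConstLp_coeFn_notMem (p := 2) (hs := hs)
      (hμs := hb.measure_lt_top.ne) (c := WithLp.toLp 2 v)] with t h ht
    exact h fun hts => absurd (hR t hts) (not_le.mpr ht)⟩

lemma indicator_ae {s : Set ℝ} (hs : MeasurableSet s) (hb : Bornology.IsBounded s)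
    (v : Fin m → ℝ) :
    ∀ᵐ t : ℝ, ((indicator s hs hb v).1 t).ofLp = s.indicator (fun _ => v) t := by
  filter_upwards [indicatorConstLp_coeFn (p := 2) (hs := hs)
      (hμs := hb.measure_lt_top.ne) (c := WithLp.toLp 2 v)] with t h
  change ((indicatorConstLp 2 hs hb.measure_lt_top.ne (WithLp.toLp 2 v)) t).ofLp = _
  rw [h]
  by_cases ht : t ∈ s <;> simp [ht]

/-- A locally integrable function orthogonal to all signals of compact support in an open set
vanishes almost everywhere on this set. -/
lemma ae_eq_zero_of_forall_integral {f : ℝ → Fin m → ℝ}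
    (hf : ∀ i, LocallyIntegrable fun t => f t i) {U : Set ℝ} (hU : IsOpen U)
    (h : ∀ u : CSignal m, (∀ᵐ t : ℝ, t ∉ U → (u.1 t).ofLp = 0) →
      ∫ t, (u.1 t).ofLp ⬝ᵥ f t = 0) : ∀ᵐ t : ℝ, t ∈ U → f t = 0 := by
  have key : ∀ i, ∀ᵐ t : ℝ, t ∈ U → f t i = 0 := by
    intro i
    have hloc : LocallyIntegrable (U.indicator fun t => f t i) volume :=
      (hf i).indicator hU.measurableSet
    have hae := ae_eq_zero_of_forall_setIntegral_isCompact_eq_zero' hloc fun K hK => by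
      have hKU : MeasurableSet (K ∩ U) := hK.measurableSet.inter hU.measurableSet
      have hb : Bornology.IsBounded (K ∩ U) := hK.isBounded.subset Set.inter_subset_left
      -- This test signal extracts the integral of the `i`-th component over `K ∩ U`.
      have h0 := h (indicator (K ∩ U) hKU hb (Pi.single i 1)) (by
        filter_upwards [indicator_ae hKU hb (Pi.single i 1)] with t ht htU
        rw [ht, Set.indicator_of_notMem fun hc => htU hc.2])
      rw [setIntegral_indicator hU.measurableSet, ← integral_indicator hKU, ← h0]
      refine integral_congr_ae ?_
      filter_upwards [indicator_ae hKU hb (Pi.single i 1)] with t ht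
      rw [ht]
      by_cases htK : t ∈ K ∩ U <;> simp [htK]
    filter_upwards [hae] with t ht htU
    rwa [Set.indicator_of_mem htU] at ht
  filter_upwards [ae_all_iff.mpr key] with t ht htU
  exact funext fun i => ht i htU

lemma inner_matrixAct (M : Matrix (Fin m) (Fin m) ℝ) (u v : CSignal m) :
    inner ℝ (matrixAct M u) v = inner ℝ u (matrixAct Mᵀ v) := by
  rw [inner_eq_integral, inner_eq_integral]
  refine integral_congr_ae ?_
  filter_upwards [matrixAct_ae M u, matrixAct_ae Mᵀ v] with t h1 h2
  rw [h1, h2, Matrix.mulVec_transpose, dotProduct_comm, Matrix.dotProduct_mulVec,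
    dotProduct_comm]

lemma locallyIntegrable_apply (u : CSignal m) (i : Fin m) :
    LocallyIntegrable fun t => (u.1 t).ofLp i := by
  refine Integrable.locallyIntegrable ?_
  have h := (u.integrable_mulVec (fun _ => (1 : Matrix (Fin m) (Fin m) ℝ)) continuous_const).eval i
  simpa using h

end CSignal

/-! ### Green's identity and the orthogonal companion of the graph. -/

namespace LTISystem

variable {n m : ℕ}

/-- Green's identity between a system and its adjoint. -/
lemma IsVolterraOutput.inner_eq {S : LTISystem n m} (hS : S.IsObservable) {u y v : CSignal m}
    (h : S.IsVolterraOutput u y) {p : ℝ → Fin n → ℝ} (hp : S.adjoint.IsStateTrajectory p v) :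
    inner ℝ y v
      = (∫ t, (u.1 t).ofLp ⬝ᵥ (S.Bᵀ *ᵥ p t)) + inner ℝ u (matrixAct S.Dᵀ v) := by
  obtain ⟨R₁, hu⟩ := u.exists_ae_eq_zero
  obtain ⟨R₂, hy⟩ := y.exists_ae_eq_zero
  have hx := S.isStateTrajectory_state u
  have hT := h.terminal_eq_zero hS
  -- Strictly beyond both supports, so that the state vanishes at `R` and `-R`, and positive, so
  -- that `[-R, R]` is a genuine interval.
  set R := max (max R₁ R₂) 0 + 1 with hR
  have hR0 : 0 < R := by positivity
  have hR1 : R₁ < R := by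
    have := (le_max_left R₁ R₂).trans (le_max_left _ (0 : ℝ)); linarith
  have hR2 : R₂ < R := by
    have := (le_max_right R₁ R₂).trans (le_max_left _ (0 : ℝ)); linarith
  have hBp : Continuous fun t => S.Bᵀ *ᵥ p t := continuous_const.matrix_mulVec hp.1
  set F : ℝ → ℝ := fun t => (u.1 t).ofLp ⬝ᵥ (S.Bᵀ *ᵥ p t)
    + (u.1 t).ofLp ⬝ᵥ ((matrixAct S.Dᵀ v).1 t).ofLp - (y.1 t).ofLp ⬝ᵥ (v.1 t).ofLp with hF
  -- The integrated derivative of `pᵀx`; both boundary values vanish with `x`.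
  have hprod := dotProduct_sub_eq_integral
    (fun a b => S.adjoint.intervalIntegrable_rhs hp.1 v a b)
    (fun a b => S.intervalIntegrable_rhs hx.1 u a b) hp.2 hx.2 hp.1 hx.1 (-R) R
  rw [S.state_eq_zero hu hT (lt_abs.mpr (Or.inl hR1)),
    S.state_eq_zero hu hT (t := -R) (by rw [abs_neg]; exact lt_abs.mpr (Or.inl hR1)),
    dotProduct_zero, dotProduct_zero, sub_zero] at hprod
  have hFint : ∫ t in (-R)..R, F t = 0 := by
    rw [hprod]
    refine intervalIntegral.integral_congr_ae ?_
    filter_upwards [h, matrixAct_ae S.Dᵀ v] with t ht htD _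
    rw [volterraOutput_eq] at ht
    simp only [hF, htD, ht, adjoint, Matrix.neg_mulVec, add_dotProduct, dotProduct_add,
      neg_dotProduct, Matrix.mulVec_transpose, Matrix.dotProduct_mulVec]
    rw [dotProduct_comm (u.1 t).ofLp (p t ᵥ* S.B),
      dotProduct_comm (u.1 t).ofLp ((v.1 t).ofLp ᵥ* S.D),
      ← Matrix.dotProduct_mulVec (v.1 t).ofLp S.D, ← Matrix.dotProduct_mulVec (v.1 t).ofLp S.C,
      dotProduct_comm (v.1 t).ofLp, dotProduct_comm (v.1 t).ofLp,
      ← Matrix.dotProduct_mulVec (p t) S.A]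
    ring
  have hFfull : ∫ t, F t = 0 := by
    rw [← hFint, intervalIntegral.integral_of_le (by linarith)]
    refine (setIntegral_eq_integral_of_ae_compl_eq_zero ?_).symm
    -- The interval integral is over `(-R, R]`. With the endpoint `-R` discarded, only points with
    -- `R ≤ |t|` lie outside.
    have hne : ∀ᵐ t : ℝ, t ≠ -R := Measure.ae_ne volume _
    filter_upwards [hu, hy, hne] with t hut hyt htne htR
    have : R ≤ |t| := by
      by_contra hc
      have := abs_lt.mp (not_le.mp hc)
      exact htR ⟨this.1, this.2.le⟩
    simp only [hF, hut (by linarith), hyt (by linarith), zero_dotProduct, add_zero, sub_zero]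
  have i1 := u.integrable_dotProduct_continuous hBp
  have i2 := u.integrable_dotProduct (matrixAct S.Dᵀ v)
  have i3 := y.integrable_dotProduct v
  have e1 := integral_sub (i1.add i2) i3
  simp only [Pi.add_apply] at e1
  rw [hF, e1, integral_add i1 i2, ← CSignal.inner_eq_integral,
    ← CSignal.inner_eq_integral] at hFfull
  linarith

/-- The terminal state as a linear map. -/
noncomputable def terminalMap (S : LTISystem n m) : CSignal m →ₗ[ℝ] (Fin n → ℝ) where
  toFun := S.terminal
  map_add' u v := by
    rw [terminal, terminal, terminal,
      ← integral_add (S.integrable_reachKernel u) (S.integrable_reachKernel v)]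
    refine integral_congr_ae ?_
    filter_upwards [CSignal.add_ae u v] with t h
    rw [h, WithLp.ofLp_add, Matrix.mulVec_add]
  map_smul' c u := by
    rw [terminal, terminal, RingHom.id_apply, ← integral_smul]
    refine integral_congr_ae ?_
    filter_upwards [CSignal.smul_ae c u] with t h
    rw [h, WithLp.ofLp_smul, Matrix.mulVec_smul]

lemma dotProduct_terminal (S : LTISystem n m) (c : Fin n → ℝ) (u : CSignal m) :
    c ⬝ᵥ S.terminal u = ∫ t, (u.1 t).ofLp ⬝ᵥ ((S.reachKernel t)ᵀ *ᵥ c) := by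
  have h := (LinearMap.toContinuousLinearMap (dotProductBilin ℝ ℝ c)).integral_comp_comm
    (S.integrable_reachKernel u)
  refine Eq.trans h.symm (integral_congr_ae (Filter.Eventually.of_forall fun t => ?_))
  change c ⬝ᵥ (S.reachKernel t *ᵥ (u.1 t).ofLp) = _
  rw [Matrix.dotProduct_mulVec, dotProduct_comm, ← Matrix.mulVec_transpose]

/-- A linear functional that vanishes on the inputs with zero terminal state is a combination of the
components of the terminal state. -/
lemma exists_eq_dotProduct_terminal (S : LTISystem n m) (K : CSignal m →ₗ[ℝ] ℝ)
    (h : ∀ u, S.terminal u = 0 → K u = 0) : ∃ c : Fin n → ℝ, ∀ u, K u = c ⬝ᵥ S.terminal u := by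
  have hK : K ∈ Submodule.span ℝ
      (Set.range fun i : Fin n => (LinearMap.proj i : (Fin n → ℝ) →ₗ[ℝ] ℝ) ∘ₗ S.terminalMap) := by
    refine mem_span_of_iInf_ker_le_ker fun u hu => ?_
    refine h u (funext fun i => ?_)
    exact (Submodule.mem_iInf _).mp hu i
  obtain ⟨c, hc⟩ := (Submodule.mem_span_range_iff_exists_fun ℝ).mp hK
  refine ⟨c, fun u => ?_⟩
  rw [← hc]
  simp [dotProduct, terminalMap]

/-- Free outputs of the adjoint system are exactly the functions that represent functionals of the
terminal state. This duality links observability of the adjoint to reachability. -/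
lemma adjoint_state_kernel (S : LTISystem n m) (t : ℝ) (c : Fin n → ℝ) :
    S.Bᵀ *ᵥ (expm S.adjoint.A t *ᵥ c) = (S.reachKernel t)ᵀ *ᵥ c := by
  rw [adjoint, expm_neg_matrix, expm_transpose, reachKernel, Matrix.transpose_mul,
    Matrix.mulVec_mulVec]

/-- The pairing with a continuous function as a linear functional. -/
noncomputable def continuousPairing {q : ℝ → Fin m → ℝ} (hq : Continuous q) :
    CSignal m →ₗ[ℝ] ℝ where
  toFun u := ∫ t, (u.1 t).ofLp ⬝ᵥ q t
  map_add' u v := by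
    rw [← integral_add (u.integrable_dotProduct_continuous hq)
      (v.integrable_dotProduct_continuous hq)]
    refine integral_congr_ae ?_
    filter_upwards [CSignal.add_ae u v] with t h
    rw [h, WithLp.ofLp_add, add_dotProduct]
  map_smul' c u := by
    rw [RingHom.id_apply, ← integral_smul]
    refine integral_congr_ae ?_
    filter_upwards [CSignal.smul_ae c u] with t h
    rw [h, WithLp.ofLp_smul, smul_dotProduct]

/-- The compact support behavior of the adjoint system is the orthogonal companion of the graph of
the Volterra operator of an observable system. -/
lemma mem_adjoint_compactBehavior_iff {S : LTISystem n m} (hS : S.IsObservable)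
    {v w : CSignal m} :
    (v, w) ∈ S.adjoint.compactBehavior ↔
      ∀ u y, S.IsVolterraOutput u y → inner ℝ y v = inner ℝ u w := by
  constructor
  · rintro ⟨p, hpc, hp, hw⟩ u y h
    have hBp : Continuous fun t => S.Bᵀ *ᵥ p t := continuous_const.matrix_mulVec hpc
    rw [h.inner_eq hS ⟨hpc, hp⟩, CSignal.inner_eq_integral, CSignal.inner_eq_integral,
      ← integral_add (u.integrable_dotProduct_continuous hBp) (u.integrable_dotProduct _)]
    refine integral_congr_ae ?_
    filter_upwards [hw, matrixAct_ae S.Dᵀ v] with t h1 h2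
    rw [h2, ← dotProduct_add]
    exact congrArg _ h1.symm
  · intro h
    set d := w - matrixAct S.Dᵀ v with hd
    have hq : Continuous fun t => S.Bᵀ *ᵥ S.adjoint.state v t :=
      continuous_const.matrix_mulVec (S.adjoint.continuous_state v)
    -- `K` measures the failure of the adjoint trajectory from rest to produce the output `w`. By
    -- Green's identity it vanishes on the domain of the Volterra operator, so it has the form `c ⬝ᵥ
    -- terminal`.
    let K : CSignal m →ₗ[ℝ] ℝ := continuousPairing hq - (innerₛₗ ℝ d)
    have hKapp : ∀ u, K u = (∫ t, (u.1 t).ofLp ⬝ᵥ (S.Bᵀ *ᵥ S.adjoint.state v t)) - inner ℝ u d := by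
      intro u
      rw [real_inner_comm]; rfl
    obtain ⟨c, hc⟩ := S.exists_eq_dotProduct_terminal K fun u hu => by
      obtain ⟨y, hy⟩ := S.exists_isVolterraOutput hu
      have h1 := hy.inner_eq hS (S.adjoint.isStateTrajectory_state v)
      rw [h u y hy] at h1
      rw [hKapp, hd, inner_sub_right, h1]; ring
    -- Shifting the initial adjoint state by `-c` changes `Bᵀ p` by exactly the kernel of the
    -- functional `K`, so the defect disappears.
    set ξ : ℝ → Fin n → ℝ := fun t => S.adjoint.reach v t - c with hξ
    have hξc : Continuous ξ := (S.adjoint.continuous_reach v).sub continuous_const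
    have hp := S.adjoint.isStateTrajectory_expm v hξc fun a b => by
      rw [← S.adjoint.reach_sub_reach]; simp [hξ]
    set p : ℝ → Fin n → ℝ := fun t => expm S.adjoint.A t *ᵥ ξ t with hpdef
    have hpe : ∀ t, S.Bᵀ *ᵥ p t
        = S.Bᵀ *ᵥ S.adjoint.state v t - (S.reachKernel t)ᵀ *ᵥ c := fun t => by
      rw [hpdef, ← adjoint_state_kernel, state, ← Matrix.mulVec_sub, ← Matrix.mulVec_sub]
    have hBp : Continuous fun t => S.Bᵀ *ᵥ p t := continuous_const.matrix_mulVec hp.1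
    have hk : Continuous fun t => (S.reachKernel t)ᵀ *ᵥ c :=
      S.continuous_reachKernel.matrix_transpose.matrix_mulVec continuous_const
    have hae := CSignal.ae_eq_zero_of_forall_integral
      (f := fun t => S.Bᵀ *ᵥ p t - (d.1 t).ofLp) (fun i =>
        ((continuous_apply i).comp hBp).locallyIntegrable.sub (d.locallyIntegrable_apply i))
      isOpen_univ fun u _ => by
        have h1 := hc u
        rw [hKapp, dotProduct_terminal, CSignal.inner_eq_integral] at h1
        simp only [hpe, dotProduct_sub]
        have e1 := integral_sub ((u.integrable_dotProduct_continuous hq).sub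
          (u.integrable_dotProduct_continuous hk)) (u.integrable_dotProduct d)
        simp only [Pi.sub_apply] at e1
        rw [e1, integral_sub (u.integrable_dotProduct_continuous hq)
          (u.integrable_dotProduct_continuous hk)]
        linarith
    refine ⟨p, hp.1, hp.2, ?_⟩
    have hsum : ∀ᵐ t : ℝ, w.1 t = d.1 t + (matrixAct S.Dᵀ v).1 t := by
      have := CSignal.add_ae d (matrixAct S.Dᵀ v)
      rwa [hd, sub_add_cancel] at this
    filter_upwards [hae, hsum, matrixAct_ae S.Dᵀ v] with t h1 h2 h3
    change (w.1 t).ofLp = S.Bᵀ *ᵥ p t + S.Dᵀ *ᵥ (v.1 t).ofLp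
    rw [h2, WithLp.ofLp_add, h3, sub_eq_zero.mp (h1 (Set.mem_univ t))]

end LTISystem

/-! ### The compact support behavior determines the transfer matrix. -/

namespace LTISystem

variable {n n' m : ℕ}

/-- Both behaviors are graphs of Volterra operators, and these depend only on the impulse response
and the feedthrough matrix. -/
lemma SameMarkov.compactBehavior_eq {S : LTISystem n m} {S' : LTISystem n' m}
    (hS : S.IsObservable) (hS' : S'.IsObservable) (h : S.SameMarkov S') :
    S.compactBehavior = S'.compactBehavior := by
  ext ⟨u, y⟩
  rw [mem_compactBehavior_iff hS, mem_compactBehavior_iff hS']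
  simp only [IsVolterraOutput, volterraOutput, h.impulse_eq, h.1]

/-- A controllable system reaches every state with inputs supported arbitrarily late. -/
lemma exists_terminal_eq {S : LTISystem n m} (hc : S.adjoint.IsObservable) (R : ℝ)
    (η : Fin n → ℝ) :
    ∃ u : CSignal m, (∀ᵐ t : ℝ, t ∉ Set.Ioi R → (u.1 t).ofLp = 0) ∧ S.terminal u = η := by
  let W : Submodule ℝ (CSignal m) :=
    { carrier := {u | ∀ᵐ t : ℝ, t ∉ Set.Ioi R → (u.1 t).ofLp = 0}
      zero_mem' := by
        filter_upwards [Lp.coeFn_zero (EuclideanSpace ℝ (Fin m)) 2 (volume : Measure ℝ)] with t h _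
        change ((0 : L2Signal m) t).ofLp = 0
        rw [h]; rfl
      add_mem' := fun {u v} hu hv => by
        filter_upwards [hu, hv, CSignal.add_ae u v] with t h1 h2 h3 ht
        rw [h3, WithLp.ofLp_add, h1 ht, h2 ht, add_zero]
      smul_mem' := fun c u hu => by
        filter_upwards [hu, CSignal.smul_ae c u] with t h1 h2 ht
        rw [h2, WithLp.ofLp_smul, h1 ht, smul_zero] }
  suffices htop : W.map S.terminalMap = ⊤ by
    obtain ⟨u, hu, e⟩ := (Submodule.eq_top_iff'.mp htop) η
    exact ⟨u, hu, e⟩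
  by_contra hne
  -- A nonzero functional `c` that kills all reachable states would make the free output of the
  -- adjoint system from `c` vanish on `(R, ∞)`, against observability of the adjoint.
  obtain ⟨f, hf, hle⟩ := Submodule.exists_le_ker_of_lt_top _ (lt_top_iff_ne_top.mpr hne)
  set c : Fin n → ℝ := fun i => f fun j => if i = j then 1 else 0
  have hfc : ∀ x, f x = c ⬝ᵥ x := fun x => by
    rw [LinearMap.pi_apply_eq_sum_univ f x, dotProduct_comm]
    rfl
  have hk : Continuous fun t => (S.reachKernel t)ᵀ *ᵥ c :=
    S.continuous_reachKernel.matrix_transpose.matrix_mulVec continuous_const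
  have hae := CSignal.ae_eq_zero_of_forall_integral (f := fun t => (S.reachKernel t)ᵀ *ᵥ c)
    (fun i => ((continuous_apply i).comp hk).locallyIntegrable) isOpen_Ioi fun u hu => by
      rw [← dotProduct_terminal, ← hfc]
      exact hle ⟨u, hu, rfl⟩
  have hc0 : c = 0 := hc.eq_zero_of_ae isOpen_Ioi Set.nonempty_Ioi (by
    filter_upwards [hae] with t ht htR
    rw [← ht htR, ← adjoint_state_kernel]
    rfl)
  refine hf (LinearMap.ext fun x => ?_)
  rw [hfc, hc0, zero_dotProduct, LinearMap.zero_apply]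

/-- Causality of the Volterra operator. -/
lemma volterraOutput_ae_eq_zero (S : LTISystem n m) {u : CSignal m} {R : ℝ}
    (hu : ∀ᵐ t : ℝ, t ∉ Set.Ioi R → (u.1 t).ofLp = 0) :
    ∀ᵐ t : ℝ, t < R → S.volterraOutput u t = 0 := by
  filter_upwards [hu] with t ht htR
  have hr : S.reach u t = 0 := by
    refine setIntegral_eq_zero_of_ae_eq_zero ?_
    filter_upwards [hu] with τ h hτ
    rw [h (not_lt.mpr ((Set.mem_Iic.mp hτ).trans htR.le)), Matrix.mulVec_zero]
  rw [volterraOutput_eq, state, hr, ht (not_lt.mpr htR.le)]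
  simp

/-- The output of the Volterra operator for an input that is constant on the unit interval. -/
lemma volterraOutput_indicator (S : LTISystem n m) (v : Fin m → ℝ) :
    ∀ᵐ t : ℝ, t ∈ Set.Ioo (0 : ℝ) 1 →
      S.volterraOutput (CSignal.indicator (Set.Ioc 0 1) measurableSet_Ioc
        (Metric.isBounded_Ioc 0 1) v) t = (∫ s in (0 : ℝ)..t, S.impulse s *ᵥ v) + S.D *ᵥ v := by
  have hind := CSignal.indicator_ae measurableSet_Ioc (Metric.isBounded_Ioc (0 : ℝ) 1) v
  filter_upwards [hind] with t ht ht01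
  rw [volterraOutput, ht, Set.indicator_of_mem (show t ∈ Set.Ioc (0 : ℝ) 1 from
    ⟨ht01.1, ht01.2.le⟩)]
  congr 1
  have e : ∫ s in (0 : ℝ)..t, S.impulse s *ᵥ v = ∫ τ in (0 : ℝ)..t, S.impulse (t - τ) *ᵥ v := by
    rw [intervalIntegral.integral_comp_sub_left (fun s => S.impulse s *ᵥ v) t, sub_self, sub_zero]
  have hset : Set.Iic t ∩ Set.Ioc (0 : ℝ) 1 = Set.Ioc 0 t := by
    ext τ
    simp only [Set.mem_inter_iff, Set.mem_Iic, Set.mem_Ioc]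
    exact ⟨fun h => ⟨h.2.1, h.1⟩, fun h => ⟨h.2, h.1, h.2.trans ht01.2.le⟩⟩
  rw [e, intervalIntegral.integral_of_le ht01.1.le, ← hset,
    ← setIntegral_indicator measurableSet_Ioc]
  refine integral_congr_ae (ae_restrict_of_ae ?_)
  filter_upwards [hind] with τ hτ
  rw [hτ]
  by_cases h : τ ∈ Set.Ioc (0 : ℝ) 1 <;> simp only [h, Set.indicator_of_mem,
    Set.indicator_of_notMem, not_false_eq_true, Matrix.mulVec_zero]

/-- Systems with the same Volterra operator have the same Markov parameters. -/
lemma sameMarkov_of_volterraOutput {S : LTISystem n m} {S' : LTISystem n' m}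
    (h : ∀ u : CSignal m, ∀ᵐ t : ℝ, S.volterraOutput u t = S'.volterraOutput u t) :
    S.SameMarkov S' := by
  have hc : ∀ {k : ℕ} (T : LTISystem k m) (v : Fin m → ℝ),
      Continuous fun s => T.impulse s *ᵥ v := fun T v =>
    T.continuous_impulse.matrix_mulVec continuous_const
  have hder : ∀ {k : ℕ} (T : LTISystem k m) (v : Fin m → ℝ) (t : ℝ),
      HasDerivAt (fun t => (∫ s in (0 : ℝ)..t, T.impulse s *ᵥ v) + T.D *ᵥ v)
        (T.impulse t *ᵥ v) t := fun T v t =>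
    (intervalIntegral.integral_hasDerivAt_right ((hc T v).intervalIntegrable 0 t)
      ((hc T v).stronglyMeasurableAtFilter _ _) (hc T v).continuousAt).add_const _
  have hcont : ∀ {k : ℕ} (T : LTISystem k m) (v : Fin m → ℝ),
      Continuous fun t => (∫ s in (0 : ℝ)..t, T.impulse s *ᵥ v) + T.D *ᵥ v := fun T v =>
    continuous_iff_continuousAt.mpr fun t => (hder T v t).continuousAt
  -- The step responses agree almost everywhere on `(0,1)`, hence everywhere there by continuity.
  have heq : ∀ v : Fin m → ℝ, Set.EqOn
      (fun t => (∫ s in (0 : ℝ)..t, S.impulse s *ᵥ v) + S.D *ᵥ v)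
      (fun t => (∫ s in (0 : ℝ)..t, S'.impulse s *ᵥ v) + S'.D *ᵥ v) (Set.Ioo 0 1) := by
    intro v
    refine Measure.eqOn_open_of_ae_eq (μ := volume) ?_ isOpen_Ioo (hcont S v).continuousOn
      (hcont S' v).continuousOn
    refine (ae_restrict_iff' measurableSet_Ioo).mpr ?_
    filter_upwards [h _, S.volterraOutput_indicator v, S'.volterraOutput_indicator v]
      with t h1 h2 h3 ht
    rw [← h2 ht, ← h3 ht, h1]
  -- The limit of the step response at `0` gives the feedthrough, its derivative the impulse
  -- response.
  refine ⟨Matrix.ext_of_mulVec_single fun i => ?_, markov_eq_of_impulse_eqOn fun t ht =>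
    Matrix.ext_of_mulVec_single fun i => ?_⟩
  · have h1 := (heq (Pi.single i 1)).closure (hcont S _) (hcont S' _)
    rw [closure_Ioo (by norm_num)] at h1
    simpa using h1 (Set.left_mem_Icc.mpr zero_le_one)
  · refine (hder S _ t).unique ((hder S' _ t).congr_of_eventuallyEq ?_)
    filter_upwards [isOpen_Ioo.mem_nhds ht] with s hs using heq _ hs

/-- If the compact support behavior of a minimal system is contained in that of an observable one,
the Markov parameters agree. -/
lemma sameMarkov_of_compactBehavior_le {S : LTISystem n m} {S' : LTISystem n' m}
    (hS : S.IsObservable) (hc : S.adjoint.IsObservable) (hS' : S'.IsObservable)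
    (h : S.compactBehavior ≤ S'.compactBehavior) : S.SameMarkov S' := by
  refine sameMarkov_of_volterraOutput fun u => ?_
  have key : ∀ N : ℕ, ∀ᵐ t : ℝ, t < N → S.volterraOutput u t = S'.volterraOutput u t := by
    intro N
    -- A correction after time `N` returns the state to rest, so `u + u'` lies in the domain and the
    -- inclusion applies to it. Before `N` the correction has no effect on either output.
    obtain ⟨u', hu', e⟩ := exists_terminal_eq hc N (-S.terminal u)
    have h0 : S.terminal (u + u') = 0 := by
      have := S.terminalMap.map_add u u'
      change S.terminal (u + u') = S.terminal u + S.terminal u' at this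
      rw [this, e, add_neg_cancel]
    obtain ⟨y, hy⟩ := S.exists_isVolterraOutput h0
    have hy' : S'.IsVolterraOutput (u + u') y :=
      (mem_compactBehavior_iff hS').mp (h ((mem_compactBehavior_iff hS).mpr hy))
    filter_upwards [hy, hy', S.volterraOutput_add u u', S'.volterraOutput_add u u',
      S.volterraOutput_ae_eq_zero hu', S'.volterraOutput_ae_eq_zero hu'] with t h1 h2 h3 h4 h5 h6 ht
    rw [h1, h3, h4, h5 ht, h6 ht, add_zero, add_zero] at h2
    exact h2
  filter_upwards [ae_all_iff.mpr key] with t ht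
  obtain ⟨N, hN⟩ := exists_nat_gt t
  exact ht N hN

end LTISystem

/-! ### Signature matrices and the conjugated adjoint system. -/

lemma IsSignatureMatrix.mul_self {m : ℕ} {σ : Matrix (Fin m) (Fin m) ℝ}
    (h : IsSignatureMatrix σ) : σ * σ = 1 := by
  obtain ⟨d, hd, rfl⟩ := h
  rw [Matrix.diagonal_mul_diagonal, ← Matrix.diagonal_one]
  congr 1
  funext i
  rcases hd i with h | h <;> simp [h]

lemma IsSignatureMatrix.transpose_eq {m : ℕ} {σ : Matrix (Fin m) (Fin m) ℝ}
    (h : IsSignatureMatrix σ) : σᵀ = σ := by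
  obtain ⟨d, -, rfl⟩ := h
  exact Matrix.diagonal_transpose d

lemma isSignatureMatrix_one {m : ℕ} : IsSignatureMatrix (1 : Matrix (Fin m) (Fin m) ℝ) :=
  ⟨fun _ => 1, fun _ => Or.inl rfl, Matrix.diagonal_one.symm⟩

lemma matrixAct_one {m : ℕ} : matrixAct (1 : Matrix (Fin m) (Fin m) ℝ) = LinearMap.id := by
  refine LinearMap.ext fun u => Subtype.ext (Lp.ext ?_)
  filter_upwards [matrixAct_ae 1 u] with t h
  rw [Matrix.one_mulVec] at h
  exact WithLp.ofLp_injective 2 h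

lemma matrixAct_matrixAct {m : ℕ} {σ : Matrix (Fin m) (Fin m) ℝ} (h : σ * σ = 1)
    (u : CSignal m) : matrixAct σ (matrixAct σ u) = u := by
  refine Subtype.ext (Lp.ext ?_)
  filter_upwards [matrixAct_ae σ (matrixAct σ u), matrixAct_ae σ u] with t h1 h2
  rw [h2, Matrix.mulVec_mulVec, h, Matrix.one_mulVec] at h1
  exact WithLp.ofLp_injective 2 h1

namespace LTISystem

variable {n m : ℕ}

/-- The system obtained by multiplying inputs and outputs by a constant matrix. -/
def conj (S : LTISystem n m) (σ : Matrix (Fin m) (Fin m) ℝ) : LTISystem n m where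
  A := S.A
  B := S.B * σ
  C := σ * S.C
  D := σ * S.D * σ

lemma IsObservable.conj {S : LTISystem n m} (hS : S.IsObservable)
    {σ : Matrix (Fin m) (Fin m) ℝ} (hσ : σ * σ = 1) : (S.conj σ).IsObservable := by
  refine fun x hx => hS x fun j => ?_
  have h := congrArg (fun y => σ *ᵥ y) (hx j)
  simpa only [LTISystem.conj, Matrix.mulVec_mulVec, ← Matrix.mul_assoc, hσ, Matrix.one_mul,
    Matrix.mulVec_zero] using h

lemma mem_compactBehavior_conj (S : LTISystem n m) {σ : Matrix (Fin m) (Fin m) ℝ}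
    (hσ : σ * σ = 1) {u y : CSignal m} :
    (u, y) ∈ (S.conj σ).compactBehavior ↔ (matrixAct σ u, matrixAct σ y) ∈ S.compactBehavior := by
  refine exists_congr fun x => and_congr_right fun _ => and_congr ?_ ?_
  · refine forall₂_congr fun a b => ?_
    rw [intervalIntegral.integral_congr_ae (g := fun t => S.A *ᵥ x t
      + S.B *ᵥ ((matrixAct σ u).1 t).ofLp)]
    filter_upwards [matrixAct_ae σ u] with t h _
    rw [h, Matrix.mulVec_mulVec]
    rfl
  · refine Filter.eventually_congr ?_
    filter_upwards [matrixAct_ae σ u, matrixAct_ae σ y] with t h1 h2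
    change (y.1 t).ofLp = (σ * S.C) *ᵥ x t + (σ * S.D * σ) *ᵥ (u.1 t).ofLp ↔
      ((matrixAct σ y).1 t).ofLp = S.C *ᵥ x t + S.D *ᵥ ((matrixAct σ u).1 t).ofLp
    rw [h1, h2]
    constructor <;> intro h
    · simp only [h, Matrix.mulVec_add, Matrix.mulVec_mulVec, ← Matrix.mul_assoc, hσ, Matrix.one_mul]
    · have h' := congrArg (fun z => σ *ᵥ z) h
      simpa only [Matrix.mulVec_add, Matrix.mulVec_mulVec, ← Matrix.mul_assoc, hσ, Matrix.one_mul,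
        Matrix.one_mulVec] using h'

lemma resolvent_adjoint (S : LTISystem n m) (s : ℂ) :
    s • (1 : Matrix (Fin n) (Fin n) ℂ) - toComplexMatrix (-S.Aᵀ)
      = -((-s) • (1 : Matrix (Fin n) (Fin n) ℂ) - toComplexMatrix S.A)ᵀ := by
  rw [toComplexMatrix_neg, toComplexMatrix_transpose, Matrix.transpose_sub, Matrix.transpose_smul,
    Matrix.transpose_one, neg_smul]
  abel

lemma regular_adjoint_conj (S : LTISystem n m) (σ : Matrix (Fin m) (Fin m) ℝ) (s : ℂ) :
    (S.adjoint.conj σ).Regular s ↔ S.Regular (-s) := by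
  change IsUnit (s • (1 : Matrix (Fin n) (Fin n) ℂ) - toComplexMatrix (-S.Aᵀ)) ↔ _
  rw [resolvent_adjoint, IsUnit.neg_iff, Matrix.isUnit_transpose]
  rfl

lemma transfer_adjoint_conj (S : LTISystem n m) {σ : Matrix (Fin m) (Fin m) ℝ} {s : ℂ}
    (hs : S.Regular (-s)) :
    (S.adjoint.conj σ).transfer s
      = toComplexMatrix σ * (S.transfer (-s))ᵀ * toComplexMatrix σ := by
  set R := (-s) • (1 : Matrix (Fin n) (Fin n) ℂ) - toComplexMatrix S.A with hR
  have hinv : (-Rᵀ)⁻¹ = -(R⁻¹)ᵀ := by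
    refine Matrix.inv_eq_right_inv ?_
    rw [neg_mul_neg, ← Matrix.transpose_mul, Matrix.nonsing_inv_mul _
      ((Matrix.isUnit_iff_isUnit_det _).mp hs), Matrix.transpose_one]
  change toComplexMatrix (σ * S.Bᵀ)
    * (s • (1 : Matrix (Fin n) (Fin n) ℂ) - toComplexMatrix (-S.Aᵀ))⁻¹
    * toComplexMatrix (-S.Cᵀ * σ) + toComplexMatrix (σ * S.Dᵀ * σ) = _
  rw [resolvent_adjoint, ← hR, hinv, transfer, ← hR]
  simp only [toComplexMatrix_mul, toComplexMatrix_neg, toComplexMatrix_transpose,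
    Matrix.transpose_add, Matrix.transpose_mul, Matrix.mul_add, Matrix.add_mul, Matrix.mul_assoc,
    Matrix.neg_mul, Matrix.mul_neg, neg_neg]

/-- The conjugated adjoint has transfer matrix `σ K(-s)ᵀ σ`, and it is regular at `s` exactly when
`S` is regular at `-s`. -/
lemma isIOHamiltonian_iff (S : LTISystem n m) {σ : Matrix (Fin m) (Fin m) ℝ} (hσ : σ * σ = 1) :
    S.IsIOHamiltonian σ ↔ S.SameTransfer (S.adjoint.conj σ) := by
  have hσc : toComplexMatrix σ * toComplexMatrix σ = 1 := by
    rw [← toComplexMatrix_mul, hσ, toComplexMatrix_one]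
  refine forall₂_congr fun s _ => ?_
  rw [regular_adjoint_conj]
  refine forall_congr' fun hs => ?_
  rw [transfer_adjoint_conj S hs, Matrix.mul_assoc]
  constructor <;> intro h
  · rw [← h, ← Matrix.mul_assoc, hσc, Matrix.one_mul]
  · rw [h, ← Matrix.mul_assoc, hσc, Matrix.one_mul]

/-! ### The operator `σ𝒱`: graph, self-adjointness and the Lagrangian property. -/

lemma exists_isVolterraOutput_of_mem_domain {S : LTISystem n m} {σ : Matrix (Fin m) (Fin m) ℝ}
    {u : CSignal m} (hu : u ∈ ((matrixAct σ).compPMap S.restrictedVolterra).domain) :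
    ∃ y, S.IsVolterraOutput u y := hu

lemma IsVolterraOutput.mem_domain {S : LTISystem n m} {u y : CSignal m}
    (h : S.IsVolterraOutput u y) (σ : Matrix (Fin m) (Fin m) ℝ) :
    u ∈ ((matrixAct σ).compPMap S.restrictedVolterra).domain := ⟨y, h⟩

/-- The operator is defined by a choice of output, so uniqueness of the output is what identifies
its value. -/
lemma compPMap_restrictedVolterra_eq {S : LTISystem n m} {σ : Matrix (Fin m) (Fin m) ℝ}
    {u y : CSignal m} (hu : u ∈ ((matrixAct σ).compPMap S.restrictedVolterra).domain)
    (h : S.IsVolterraOutput u y) :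
    (matrixAct σ).compPMap S.restrictedVolterra ⟨u, hu⟩ = matrixAct σ y :=
  congrArg (matrixAct σ) ((Exists.choose_spec hu).unique h)

lemma mem_graph_compPMap_iff {S : LTISystem n m} {σ : Matrix (Fin m) (Fin m) ℝ} (hσ : σ * σ = 1)
    (v w : CSignal m) :
    (v, w) ∈ ((matrixAct σ).compPMap S.restrictedVolterra).graph ↔
      S.IsVolterraOutput v (matrixAct σ w) := by
  rw [LinearPMap.mem_graph_iff]
  constructor
  · rintro ⟨⟨u, hu⟩, e, hw⟩
    obtain rfl : u = v := e
    obtain ⟨y, hy⟩ := exists_isVolterraOutput_of_mem_domain hu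
    have e : w = matrixAct σ y := hw.symm.trans (compPMap_restrictedVolterra_eq hu hy)
    rwa [e, matrixAct_matrixAct hσ]
  · intro h
    refine ⟨⟨v, h.mem_domain σ⟩, rfl, ?_⟩
    exact (compPMap_restrictedVolterra_eq (h.mem_domain σ) h).trans (matrixAct_matrixAct hσ w)

/-- The orthogonality relation with the graph of `σ𝒱`, in terms of the adjoint system. -/
lemma forall_inner_compPMap_iff {S : LTISystem n m} (hS : S.IsObservable)
    {σ : Matrix (Fin m) (Fin m) ℝ} (hσ : σ * σ = 1) (hσt : σᵀ = σ) (v w : CSignal m) :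
    (∀ u : ((matrixAct σ).compPMap S.restrictedVolterra).domain,
      inner ℝ ((matrixAct σ).compPMap S.restrictedVolterra u) v = inner ℝ (u : CSignal m) w) ↔
      (v, matrixAct σ w) ∈ (S.adjoint.conj σ).compactBehavior := by
  rw [mem_compactBehavior_conj _ hσ, matrixAct_matrixAct hσ, mem_adjoint_compactBehavior_iff hS]
  have e : ∀ y, inner ℝ (matrixAct σ y) v = inner ℝ y (matrixAct σ v) := fun y => by
    rw [CSignal.inner_matrixAct, hσt]
  constructor
  · intro h u y hy
    rw [← e, ← compPMap_restrictedVolterra_eq (hy.mem_domain σ) hy]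
    exact h ⟨u, hy.mem_domain σ⟩
  · rintro h ⟨u, hu⟩
    obtain ⟨y, hy⟩ := exists_isVolterraOutput_of_mem_domain hu
    rw [compPMap_restrictedVolterra_eq hu hy, e]
    exact h _ _ hy

lemma map_compactBehavior_eq_iff (S : LTISystem n m) {σ : Matrix (Fin m) (Fin m) ℝ}
    (hσ : σ * σ = 1) :
    S.compactBehavior.map ((matrixAct σ).prodMap (matrixAct σ)) = S.adjoint.compactBehavior ↔
      S.compactBehavior = (S.adjoint.conj σ).compactBehavior := by
  have hinv := matrixAct_matrixAct hσ
  constructor <;> intro h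
  · ext ⟨u, y⟩
    rw [mem_compactBehavior_conj _ hσ, ← h]
    constructor
    · intro hu
      exact ⟨(u, y), hu, rfl⟩
    · rintro ⟨⟨u', y'⟩, hu, e⟩
      obtain ⟨e1, e2⟩ := Prod.mk.inj e
      have e1 := congrArg (matrixAct σ) e1
      have e2 := congrArg (matrixAct σ) e2
      simp only [LinearMap.comp_apply, LinearMap.fst_apply, LinearMap.snd_apply, hinv] at e1 e2
      exact e1 ▸ e2 ▸ hu
  · ext ⟨u, y⟩
    have h2 := S.adjoint.mem_compactBehavior_conj hσ (u := matrixAct σ u) (y := matrixAct σ y)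
    rw [hinv, hinv, ← h] at h2
    rw [← h2]
    constructor
    · rintro ⟨⟨u', y'⟩, hu, e⟩
      obtain ⟨e1, e2⟩ := Prod.mk.inj e
      rw [← e1, ← e2]
      simp only [LinearMap.comp_apply, LinearMap.fst_apply, LinearMap.snd_apply, hinv]
      exact hu
    · intro hu
      exact ⟨_, hu, Prod.ext (hinv u) (hinv y)⟩

/-- After the substitution `y = σ w`, the graph of `σ𝒱` becomes the behavior of `S` and the graph of
its adjoint becomes that of the conjugated adjoint system. -/
lemma isSelfAdjointOperator_iff {S : LTISystem n m} (hS : S.IsObservable)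
    {σ : Matrix (Fin m) (Fin m) ℝ} (hσ : σ * σ = 1) (hσt : σᵀ = σ) :
    IsSelfAdjointOperator ((matrixAct σ).compPMap S.restrictedVolterra) ↔
      S.compactBehavior = (S.adjoint.conj σ).compactBehavior := by
  have hinv := matrixAct_matrixAct hσ
  have e : IsSelfAdjointOperator ((matrixAct σ).compPMap S.restrictedVolterra) ↔
      ∀ v w : CSignal m, (v, matrixAct σ w) ∈ S.compactBehavior ↔
        (v, matrixAct σ w) ∈ (S.adjoint.conj σ).compactBehavior :=
    forall₂_congr fun v w => by
      rw [mem_graph_compPMap_iff hσ, forall_inner_compPMap_iff hS hσ hσt,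
        mem_compactBehavior_iff hS]
  rw [e]
  constructor <;> intro h
  · ext ⟨u, y⟩
    have := h u (matrixAct σ y)
    rwa [hinv] at this
  · intro v w
    rw [h]

/-- The subspace is the graph of `σ𝒱`, and vanishing of the symplectic form against a graph is the
relation that defines the adjoint operator. -/
lemma isLagrangian_iff_isSelfAdjointOperator {S : LTISystem n m} (hS : S.IsObservable)
    {σ : Matrix (Fin m) (Fin m) ℝ} (hσ : σ * σ = 1) :
    IsLagrangian (S.compactBehavior.map
      ((LinearMap.id : CSignal m →ₗ[ℝ] CSignal m).prodMap (matrixAct σ))) ↔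
      IsSelfAdjointOperator ((matrixAct σ).compPMap S.restrictedVolterra) := by
  have hinv := matrixAct_matrixAct hσ
  have hL : S.compactBehavior.map
      ((LinearMap.id : CSignal m →ₗ[ℝ] CSignal m).prodMap (matrixAct σ))
        = ((matrixAct σ).compPMap S.restrictedVolterra).graph := by
    ext ⟨v, w⟩
    rw [mem_graph_compPMap_iff hσ, ← mem_compactBehavior_iff hS]
    constructor
    · rintro ⟨⟨u, y⟩, hu, e⟩
      obtain ⟨e1, e2⟩ := Prod.mk.inj e
      rw [← e1, ← e2]
      simp only [LinearMap.comp_apply, LinearMap.fst_apply, LinearMap.snd_apply, hinv]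
      exact hu
    · intro h
      exact ⟨_, h, Prod.ext rfl (hinv w)⟩
  rw [hL, IsLagrangian, Prod.forall]
  refine forall₂_congr fun v w => iff_congr Iff.rfl ?_
  constructor
  · intro h u
    have := h _ (LinearPMap.mem_graph _ u)
    rw [symplecticForm, sub_eq_zero, real_inner_comm] at this
    exact this.symm
  · intro h b hb
    obtain ⟨u, e1, e2⟩ := (LinearPMap.mem_graph_iff _).mp hb
    rw [symplecticForm, ← e1, ← e2, h u, real_inner_comm, sub_self]

end LTISystem

theorem mainTheorem5 {n m : ℕ} (S : LTISystem n m) (hS : S.IsMinimal) :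
    (S.IsIOHamiltonian 1 ↔ S.compactBehavior = S.adjoint.compactBehavior) ∧
    ∀ σ : Matrix (Fin m) (Fin m) ℝ, IsSignatureMatrix σ →
      [ S.IsIOHamiltonian σ,
        S.compactBehavior.map ((matrixAct σ).prodMap (matrixAct σ))
          = S.adjoint.compactBehavior,
        IsSymmetricOperator ((matrixAct σ).compPMap S.restrictedVolterra),
        IsSelfAdjointOperator ((matrixAct σ).compPMap S.restrictedVolterra),
        IsLagrangian (S.compactBehavior.map
          ((LinearMap.id : CSignal m →ₗ[ℝ] CSignal m).prodMap (matrixAct σ))) ].TFAE := by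
  have hobs : S.IsObservable := hS.isObservable
  have hcon : S.adjoint.IsObservable := hS.adjoint.isObservable
  have main : ∀ σ : Matrix (Fin m) (Fin m) ℝ, IsSignatureMatrix σ →
      [ S.IsIOHamiltonian σ,
        S.compactBehavior.map ((matrixAct σ).prodMap (matrixAct σ))
          = S.adjoint.compactBehavior,
        IsSymmetricOperator ((matrixAct σ).compPMap S.restrictedVolterra),
        IsSelfAdjointOperator ((matrixAct σ).compPMap S.restrictedVolterra),
        IsLagrangian (S.compactBehavior.map
          ((LinearMap.id : CSignal m →ₗ[ℝ] CSignal m).prodMap (matrixAct σ))) ].TFAE := by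
    intro σ hσs
    have hσ := hσs.mul_self
    have hσt := hσs.transpose_eq
    have hobs' : (S.adjoint.conj σ).IsObservable := hcon.conj hσ
    tfae_have 1 → 2 := fun h =>
      (S.map_compactBehavior_eq_iff hσ).mpr
        (((S.isIOHamiltonian_iff hσ).mp h).sameMarkov.compactBehavior_eq hobs hobs')
    tfae_have 2 → 4 := fun h =>
      (LTISystem.isSelfAdjointOperator_iff hobs hσ hσt).mpr
        ((S.map_compactBehavior_eq_iff hσ).mp h)
    tfae_have 4 → 3 := fun h u v => (h v _).mp (LinearPMap.mem_graph _ v) u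
    -- Symmetry puts every pair of the behavior of `S` into the behavior of the conjugated adjoint;
    -- this single inclusion suffices.
    tfae_have 3 → 1 := by
      intro h
      refine (S.isIOHamiltonian_iff hσ).mpr
        (LTISystem.sameMarkov_of_compactBehavior_le hobs hcon hobs' ?_).sameTransfer
      rintro ⟨v, z⟩ hv
      have hz := (LTISystem.mem_compactBehavior_iff hobs).mp hv
      have h1 := (LTISystem.forall_inner_compPMap_iff hobs hσ hσt v _).mp fun u =>
        h u ⟨v, hz.mem_domain σ⟩
      rwa [LTISystem.compPMap_restrictedVolterra_eq (hz.mem_domain σ) hz,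
        matrixAct_matrixAct hσ] at h1
    tfae_have 5 ↔ 4 := LTISystem.isLagrangian_iff_isSelfAdjointOperator hobs hσ
    tfae_finish
  refine ⟨?_, main⟩
  have h := (main 1 isSignatureMatrix_one).out 0 1
  rwa [matrixAct_one, LinearMap.prodMap_id, Submodule.map_id] at h
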